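/- Let $X$ be a Polish space, let $\mathcal M(X)$ be the space of finite non-negative Borel measures on $X$, with the weak topology and its Borel $\sigma$-algebra, and write $\mu_x:=\mu\{x\}$. Let $\theta>0$ and let $\nu$ be a diffuse (atomless) Borel probability measure on $X$. Let $\mathcal D_{\theta\nu}$ be the Dirichlet–Ferguson measure with intensity $\theta\nu$ on the space $\mathcal P(X)$ of Borel probability measures, i.e. the law of $\sum_{k\ge 0} V_k\prod_{i<k}(1-V_i)\,\delta_{x_k}$, where all the variables are independent, $V_k$ has the Beta distribution $\theta(1-t)^{\theta-1}\,dt$ on $[0,1]$ and $x_k$ has law $\nu$. Let $d\lambda_\theta(t):=t^{\theta-1}\,dt/\Gamma(\theta)$ on $(0,\infty)$. The multiplicative infinite-dimensional Lebesgue measure $\mathcal L_{\theta,\nu}$ is the image of $\mathcal D_{\theta\nu}\otimes\lambda_\theta$ under $(\eta,t)\mapsto t\eta\in\mathcal M(X)$. Then, for every Borel measurable $F\colon \mathcal M(X)\times[0,\infty)\times X\to[0,\infty]$, $$\int_{\mathcal M(X)}\int_X F(\mu,\mu_x,x)\,d\mu(x)\,d\mathcal L_{\theta,\nu}(\mu)=\theta\int_{\mathcal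 M(X)}\int_X\int_0^\infty F(\mu+s\delta_x,s,x)\,ds\,d\nu(x)\,d\mathcal L_{\theta,\nu}(\mu).$$ -/

import Mathlib

open MeasureTheory ProbabilityTheory Filter Topology Set TopologicalSpace
open scoped ENNReal NNReal

section WeakBorel

/- Mathlib equips `FiniteMeasure X` and `ProbabilityMeasure X` with the σ-algebra generated by the
evaluations `μ ↦ μ s`. This section shows that for second countable metrizable spaces it is the
Borel σ-algebra of the weak topology. -/

lemma ennreal_tendsto_aux {a b : ℝ≥0∞} {as bs : ℕ → ℝ≥0∞} (hb : b ≠ ∞)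
    (hsum : ∀ u, a + b < u → ∀ᶠ n in atTop, as n + bs n < u)
    (hla : a ≤ liminf as atTop) (hlb : b ≤ liminf bs atTop) : Tendsto as atTop (𝓝 a) := by
  refine tendsto_order.2 ⟨fun l hl => eventually_lt_of_lt_liminf (hl.trans_le hla), fun u hu => ?_⟩
  obtain ⟨w, haw, hwu⟩ := exists_between hu
  by_cases hb0 : b = 0
  · subst hb0
    filter_upwards [hsum u (by simpa using hu)] with n hn using (le_self_add).trans_lt hn
  obtain ⟨ε, hε, hεw⟩ : ∃ ε : ℝ≥0∞, 0 < ε ∧ a + ε ≤ w :=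
    ⟨w - a, by simpa using haw, by rw [add_tsub_cancel_of_le haw.le]⟩
  have hbε : b - ε < b := ENNReal.sub_lt_self hb hb0 hε.ne'
  have h1 : ∀ᶠ n in atTop, b - ε < bs n := eventually_lt_of_lt_liminf (hbε.trans_le hlb)
  have hwt : w ≠ ∞ := (hwu.trans_le le_top).ne
  obtain ⟨w', hww', hwu'⟩ := exists_between hwu
  have hadd : a + b < w' + (b - ε) := by
    calc a + b ≤ a + ((b - ε) + ε) := by gcongr; exact le_tsub_add
      _ = (a + ε) + (b - ε) := by ring
      _ ≤ w + (b - ε) := by gcongr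
      _ < w' + (b - ε) := ENNReal.add_lt_add_right (ne_top_of_le_ne_top hb tsub_le_self) hww'
  filter_upwards [h1, hsum _ hadd] with n h1 h2
  by_contra hcon
  have : w' + (b - ε) ≤ as n + bs n := add_le_add (hwu'.le.trans (not_lt.1 hcon)) h1.le
  exact absurd h2 (not_lt.2 this)

variable {X : Type*} [TopologicalSpace X] [MeasurableSpace X]

lemma tendsto_of_open_mass [OpensMeasurableSpace X] {μ : FiniteMeasure X} {μs : ℕ → FiniteMeasure X}
    (hG : ∀ G, IsOpen G → (μ : Measure X) G ≤ atTop.liminf (fun i ↦ (μs i : Measure X) G))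
    (hm : ∀ q, (μ : Measure X) univ < q → ∀ᶠ i in atTop, (μs i : Measure X) univ < q) :
    Tendsto μs atTop (𝓝 μ) := by
  rw [FiniteMeasure.tendsto_iff_forall_lintegral_tendsto]
  intro f
  obtain ⟨C, hC⟩ : ∃ C : ℝ≥0, ∀ x, f x ≤ C := 
    ⟨nndist f 0, fun x => BoundedContinuousFunction.NNReal.upper_bound f x⟩
  have key (g : X → ℝ≥0) (hg : Continuous g) :
      ∫⁻ x, (g x : ℝ≥0∞) ∂(μ : Measure X) ≤
        atTop.liminf (fun i ↦ ∫⁻ x, (g x : ℝ≥0∞) ∂(μs i : Measure X)) := by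
    have := lintegral_le_liminf_lintegral_of_forall_isOpen_measure_le_liminf_measure
      (μ := (μ : Measure X)) (μs := fun i => (μs i : Measure X)) (f := fun x => (g x : ℝ))
      (by fun_prop) (fun x => (g x).2) hG
    simpa using this
  have hfm : Measurable f := f.continuous.measurable
  have hsum (ρ : FiniteMeasure X) : ∫⁻ x, (f x : ℝ≥0∞) ∂(ρ : Measure X) +
      ∫⁻ x, ((C - f x : ℝ≥0) : ℝ≥0∞) ∂(ρ : Measure X) = C * (ρ : Measure X) univ := by
    rw [← lintegral_add_left (by fun_prop), ← lintegral_const]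
    congr 1; ext x
    rw [← ENNReal.coe_add, add_tsub_cancel_of_le (hC x)]
  have hfin : ∫⁻ x, (f x : ℝ≥0∞) ∂(μ : Measure X) +
      ∫⁻ x, ((C - f x : ℝ≥0) : ℝ≥0∞) ∂(μ : Measure X) ≠ ∞ := by
    rw [hsum]; exact ENNReal.mul_ne_top (by simp) (measure_ne_top _ _)
  refine ennreal_tendsto_aux (b := ∫⁻ x, ((C - f x : ℝ≥0) : ℝ≥0∞) ∂(μ : Measure X))
    (bs := fun i => ∫⁻ x, ((C - f x : ℝ≥0) : ℝ≥0∞) ∂(μs i : Measure X))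
    (ENNReal.add_ne_top.1 hfin).2 ?_ (key f f.continuous)
    (key _ (by fun_prop))
  intro u hu
  simp_rw [hsum] at hu ⊢
  rcases eq_or_ne C 0 with rfl | hC0
  · exact Eventually.of_forall fun _ => by simpa using hu
  have hC1 : (C : ℝ≥0∞) ≠ 0 := by simpa using hC0
  filter_upwards [hm (u / C) (by rwa [ENNReal.lt_div_iff_mul_lt (.inl hC1) (.inl (by simp)), mul_comm])] with i hi
  rwa [ENNReal.lt_div_iff_mul_lt (.inl hC1) (.inl (by simp)), mul_comm] at hi

variable (X) in
/-- A countable subbasis of the weak topology on finite measures. -/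
def weakSubbasis [SecondCountableTopology X] : Set (Set (FiniteMeasure X)) :=
  (fun p : Set (Set X) × ℝ≥0 => {μ : FiniteMeasure X | (p.2 : ℝ≥0∞) < (μ : Measure X) (⋃₀ p.1)}) ''
    ({T : Set (Set X) | T.Finite ∧ T ⊆ countableBasis X} ×ˢ range (fun q : ℚ => Real.toNNReal q)) ∪
  (fun q : ℝ≥0 => {μ : FiniteMeasure X | (μ : Measure X) univ < q}) ''
    range (fun q : ℚ => Real.toNNReal q)

lemma countable_weakSubbasis [SecondCountableTopology X] : (weakSubbasis X).Countable := by
  refine Countable.union (Countable.image (Countable.prod ?_ (countable_range _)) _)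
    ((countable_range _).image _)
  exact countable_ofPred_finite_subset (countable_countableBasis X)

lemma exists_rat_nnreal_btwn {a b : ℝ≥0∞} (h : a < b) :
    ∃ q : ℚ, a < (Real.toNNReal q : ℝ≥0∞) ∧ (Real.toNNReal q : ℝ≥0∞) < b := by
  obtain ⟨q, -, h1, h2⟩ := ENNReal.lt_iff_exists_rat_btwn.1 h
  exact ⟨q, h1, h2⟩

lemma isOpen_lt_measure [HasOuterApproxClosed X] [OpensMeasurableSpace X] {U : Set X}
    (hU : IsOpen U) (q : ℝ≥0∞) : IsOpen {μ : FiniteMeasure X | q < (μ : Measure X) U} := by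
  have hF : IsClosed Uᶜ := hU.isClosed_compl
  have hcont (n : ℕ) : Continuous fun μ : FiniteMeasure X =>
      ((μ.mass - μ.testAgainstNN (hF.apprSeq n) : ℝ≥0) : ℝ≥0∞) := by
    have := FiniteMeasure.continuous_testAgainstNN_eval (hF.apprSeq n)
    fun_prop
  have heq (μ : FiniteMeasure X) (n : ℕ) :
      ((μ.mass - μ.testAgainstNN (hF.apprSeq n) : ℝ≥0) : ℝ≥0∞) =
      (μ : Measure X) univ - ∫⁻ x, (hF.apprSeq n x : ℝ≥0∞) ∂(μ : Measure X) := by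
    rw [ENNReal.coe_sub, FiniteMeasure.testAgainstNN_coe_eq, FiniteMeasure.ennreal_mass]
  have hUeq (μ : FiniteMeasure X) : (μ : Measure X) U = (μ : Measure X) univ - (μ : Measure X) Uᶜ := by
    rw [← measure_compl hF.measurableSet (measure_ne_top _ _), compl_compl]
  have : {μ : FiniteMeasure X | q < (μ : Measure X) U} =
      ⋃ n : ℕ, {μ | q < ((μ.mass - μ.testAgainstNN (hF.apprSeq n) : ℝ≥0) : ℝ≥0∞)} := by
    ext μ
    simp only [mem_ofPred_eq, mem_iUnion, heq, hUeq]
    constructor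
    · intro h
      have hlim : Tendsto (fun n => (μ : Measure X) univ - ∫⁻ x, (hF.apprSeq n x : ℝ≥0∞) ∂(μ : Measure X))
          atTop (𝓝 ((μ : Measure X) univ - (μ : Measure X) Uᶜ)) :=
        ENNReal.Tendsto.sub tendsto_const_nhds
          (HasOuterApproxClosed.tendsto_lintegral_apprSeq hF (μ : Measure X))
          (.inl (measure_ne_top _ _))
      exact (hlim.eventually_const_lt h).exists
    · rintro ⟨n, hn⟩
      exact hn.trans_le (tsub_le_tsub_left (HasOuterApproxClosed.measure_le_lintegral hF (μ : Measure X) n) _)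
  rw [this]
  exact isOpen_iUnion fun n => isOpen_lt continuous_const (hcont n)

lemma weak_eq_generateFrom [SecondCountableTopology X] [HasOuterApproxClosed X]
    [OpensMeasurableSpace X] :
    (FiniteMeasure.instTopologicalSpace : TopologicalSpace (FiniteMeasure X)) = generateFrom (weakSubbasis X) := by
  apply le_antisymm
  · refine le_generateFrom ?_
    rintro _ (⟨⟨T, q⟩, ⟨hT, -⟩, rfl⟩ | ⟨q, -, rfl⟩)
    · exact isOpen_lt_measure (isOpen_sUnion fun s hs => isOpen_of_mem_countableBasis (hT.2 hs)) _
    · have : Continuous fun μ : FiniteMeasure X => ((μ.mass : ℝ≥0) : ℝ≥0∞) := by fun_prop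
      simp_rw [FiniteMeasure.ennreal_mass] at this
      exact isOpen_lt this continuous_const
  · obtain ⟨t', ht'⟩ : ∃ t', t' = generateFrom (weakSubbasis X) := ⟨_, rfl⟩
    rw [← ht', ← continuous_id_iff_le]
    have hsc : @SecondCountableTopology (FiniteMeasure X) t' :=
      @SecondCountableTopology.mk _ t' ⟨_, countable_weakSubbasis, ht'⟩
    have hseq : @SequentialSpace (FiniteMeasure X) t' :=
      @FrechetUrysohnSpace.to_sequentialSpace _ t'
        (@FirstCountableTopology.frechetUrysohnSpace _ t'
          (@SecondCountableTopology.to_firstCountableTopology _ t' hsc))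
    refine @SeqContinuous.continuous _ _ t' FiniteMeasure.instTopologicalSpace hseq id ?_
    intro μs μ hμ
    have hev (S) (hS : S ∈ weakSubbasis X) (h : μ ∈ S) : ∀ᶠ i in atTop, μs i ∈ S := by
      have ho : IsOpen[t'] S := ht' ▸ isOpen_generateFrom_of_mem hS
      exact hμ (@IsOpen.mem_nhds _ t' μ S ho h)
    refine tendsto_of_open_mass (fun G hGo => ?_) fun q hq => ?_
    · refine le_of_forall_lt fun c hc => ?_
      obtain ⟨q, hcq, hqG⟩ := exists_rat_nnreal_btwn hc
      obtain ⟨S, hSB, rfl⟩ := (isBasis_countableBasis X).open_eq_sUnion hGo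
      have hSc : S.Countable := (countable_countableBasis X).mono hSB
      obtain ⟨T, hTS, hTf, hT⟩ : ∃ T ⊆ S, T.Finite ∧
          (Real.toNNReal q : ℝ≥0∞) < (μ : Measure X) (⋃₀ T) := by
        have hU : ⋃₀ S = ⋃ T ∈ {T : Set (Set X) | T.Finite ∧ T ⊆ S}, ⋃₀ T := by
          ext x
          simp only [mem_sUnion, mem_iUnion, mem_ofPred_eq, exists_prop]
          refine ⟨fun ⟨s, hs, hx⟩ => ⟨{s}, ⟨finite_singleton s, by simpa using hs⟩, s, rfl, hx⟩, ?_⟩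
          rintro ⟨T, ⟨-, hT⟩, s, hs, hx⟩
          exact ⟨s, hT hs, hx⟩
        rw [hU, measure_biUnion_eq_iSup (countable_ofPred_finite_subset hSc)] at hqG
        · simp only [lt_iSup_iff] at hqG
          obtain ⟨T, ⟨hTf, hTS⟩, hT⟩ := hqG
          exact ⟨T, hTS, hTf, hT⟩
        · rintro T₁ ⟨h1, h1'⟩ T₂ ⟨h2, h2'⟩
          exact ⟨T₁ ∪ T₂, ⟨h1.union h2, union_subset h1' h2'⟩,
            sUnion_mono subset_union_left, sUnion_mono subset_union_right⟩
      have := hev _ (.inl ⟨⟨T, Real.toNNReal q⟩, ⟨⟨hTf, hTS.trans hSB⟩, ⟨q, rfl⟩⟩, rfl⟩) hT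
      refine hcq.trans_le (le_liminf_of_le (by isBoundedDefault) ?_)
      filter_upwards [this] with i hi
      exact (le_of_lt hi).trans (measure_mono (sUnion_mono hTS))
    · obtain ⟨r, h1, h2⟩ := exists_rat_nnreal_btwn hq
      filter_upwards [hev _ (.inr ⟨Real.toNNReal r, ⟨r, rfl⟩, rfl⟩) h1] with i hi
      exact lt_trans hi h2

instance [SecondCountableTopology X] [HasOuterApproxClosed X] [OpensMeasurableSpace X] :
    SecondCountableTopology (FiniteMeasure X) :=
  ⟨_, countable_weakSubbasis, weak_eq_generateFrom⟩

instance [SecondCountableTopology X] [HasOuterApproxClosed X] [BorelSpace X] :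
    BorelSpace (FiniteMeasure X) := by
  have hb := borel_eq_generateFrom_of_subbasis (weak_eq_generateFrom (X := X))
  have hev (s : Set X) (hs : MeasurableSet s) :
      Measurable fun μ : FiniteMeasure X => (μ : Measure X) s :=
    (Measure.measurable_coe hs).comp measurable_subtype_coe
  refine ⟨le_antisymm ?_ ?_⟩
  · have h : Measurable[borel (FiniteMeasure X)] (fun μ : FiniteMeasure X => (μ : Measure X)) := by
      let _ : MeasurableSpace (FiniteMeasure X) := borel _
      have : BorelSpace (FiniteMeasure X) := ⟨rfl⟩
      refine Measurable.measure_of_isPiSystem (S := {s | IsOpen s})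
        BorelSpace.measurable_eq isPiSystem_isOpen (fun s hs => ?_) ?_
      · exact measurable_of_Ioi fun q => (isOpen_lt_measure hs q).measurableSet
      · exact measurable_of_Ioi fun q => (isOpen_lt_measure isOpen_univ q).measurableSet
    exact h.comap_le
  · rw [hb]
    refine MeasurableSpace.generateFrom_le ?_
    rintro _ (⟨⟨T, q⟩, ⟨hT, -⟩, rfl⟩ | ⟨q, -, rfl⟩)
    · exact measurableSet_lt measurable_const (hev _ (isOpen_sUnion fun s hs =>
        isOpen_of_mem_countableBasis (hT.2 hs)).measurableSet)
    · exact measurableSet_lt (hev _ .univ) measurable_const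

instance [SecondCountableTopology X] [HasOuterApproxClosed X] [BorelSpace X] :
    BorelSpace (ProbabilityMeasure X) := by
  refine ⟨?_⟩
  have h : borel (ProbabilityMeasure X) =
      (borel (FiniteMeasure X)).comap ProbabilityMeasure.toFiniteMeasure := borel_comap
  rw [h, ← BorelSpace.measurable_eq (α := FiniteMeasure X)]
  exact (MeasurableSpace.comap_comp (m := Measure.instMeasurableSpace)
    (g := ProbabilityMeasure.toFiniteMeasure)
    (f := fun μ : FiniteMeasure X => (μ : Measure X))).symm

end WeakBorel

noncomputable section

/-- The stick-breaking weights `v k * ∏ i < k, (1 - v i)`. -/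
def stickWeight (v : ℕ → ℝ) (k : ℕ) : ℝ := v k * ∏ i ∈ Finset.range k, (1 - v i)

/-- The purely atomic measure `∑ k, w k • δ_{x k}` with stick-breaking weights `w`. -/
def stickMeasure {X : Type*} [MeasurableSpace X] (v : ℕ → ℝ) (x : ℕ → X) : Measure X :=
  Measure.sum fun k => ENNReal.ofReal (stickWeight v k) • Measure.dirac (x k)

open Classical in
/-- `stickMeasure v x` as a probability measure. It is one for almost every choice of the sticks
(see `ae_isProbabilityMeasure_stickMeasure`); the second branch is only there to make the
function total. -/
def stickProbability {X : Type*} [MeasurableSpace X] (p : (ℕ → ℝ) × (ℕ → X)) :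
    ProbabilityMeasure X :=
  if h : IsProbabilityMeasure (stickMeasure p.1 p.2) then ⟨stickMeasure p.1 p.2, h⟩
  else diracProba (p.2 0)

/-- The Dirichlet–Ferguson measure with intensity `β • ν`: the law of the random probability
measure `∑ k, V k * ∏ i < k, (1 - V i) • δ_{x k}`, where the `V k` are Beta distributed with
parameters `1` and `β`, the `x k` have law `ν`, and all these variables are independent. -/
def dirichletFerguson {X : Type*} [MeasurableSpace X] (β : ℝ) (ν : Measure X) :
    Measure (ProbabilityMeasure X) :=
  ((Measure.infinitePi fun _ : ℕ => betaMeasure 1 β).prod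
    (Measure.infinitePi fun _ : ℕ => ν)).map stickProbability

/-- The measure `t ^ (θ - 1) / Γ(θ) dt` on the half-line `t > 0`. -/
def radialMeasure (θ : ℝ) : Measure ℝ :=
  (volume.restrict (Ioi 0)).withDensity fun t => ENNReal.ofReal (t ^ (θ - 1) / Real.Gamma θ)

/-- The multiplicative infinite-dimensional Lebesgue measure with shape parameter `θ` and
intensity measure `ν`: the image of the product of the Dirichlet–Ferguson measure with intensity
`θ • ν` and of `radialMeasure θ` under `(η, t) ↦ t • η`, the inverse of
`μ ↦ (μ / μ(X), μ(X))`. -/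
def infLebesgue {X : Type*} [MeasurableSpace X] (θ : ℝ) (ν : Measure X) :
    Measure (FiniteMeasure X) :=
  ((dirichletFerguson θ ν).prod (radialMeasure θ)).map
    fun p => p.2.toNNReal • p.1.toFiniteMeasure

section Nondegeneracy

variable {X : Type*} [MeasurableSpace X]

lemma measurable_stickWeight (k : ℕ) : Measurable fun v => stickWeight v k := by
  unfold stickWeight
  fun_prop

lemma measurable_stickMeasure :
    Measurable fun p : (ℕ → ℝ) × (ℕ → X) => stickMeasure p.1 p.2 := by
  refine Measure.measurable_of_measurable_coe _ fun s hs => ?_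
  simp only [stickMeasure, Measure.sum_apply _ hs, Measure.smul_apply, smul_eq_mul]
  refine Measurable.tsum fun k => Measurable.mul ?_ ?_
  · exact ENNReal.measurable_ofReal.comp ((measurable_stickWeight k).comp measurable_fst)
  · exact (Measure.measurable_coe hs).comp
      (Measure.measurable_dirac.comp ((measurable_pi_apply k).comp measurable_snd))

lemma measurable_stickProbability :
    Measurable (stickProbability : (ℕ → ℝ) × (ℕ → X) → ProbabilityMeasure X) := by
  classical
  have hs : MeasurableSet {p : (ℕ → ℝ) × (ℕ → X) | IsProbabilityMeasure (stickMeasure p.1 p.2)} :=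
    measurable_stickMeasure
      ProbabilityMeasure.measurableSet_isProbabilityMeasure
  have h : Measurable fun p : (ℕ → ℝ) × (ℕ → X) => (stickProbability p : Measure X) := by
    have : (fun p : (ℕ → ℝ) × (ℕ → X) => (stickProbability p : Measure X)) = fun p =>
        if IsProbabilityMeasure (stickMeasure p.1 p.2) then stickMeasure p.1 p.2
        else Measure.dirac (p.2 0) := by
      ext1 p
      by_cases h : IsProbabilityMeasure (stickMeasure p.1 p.2)
      · have e : stickProbability p = (⟨stickMeasure p.1 p.2, h⟩ : ProbabilityMeasure X) := dif_pos h
        rw [if_pos h, e]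
        rfl
      · have e : stickProbability p = diracProba (p.2 0) := dif_neg h
        rw [if_neg h, e]
        rfl
    rw [this]
    exact Measurable.ite hs measurable_stickMeasure
      (Measure.measurable_dirac.comp ((measurable_pi_apply 0).comp measurable_snd))
  exact h.subtype_mk (h := fun p => (stickProbability p).2)

lemma sum_stickWeight (v : ℕ → ℝ) (n : ℕ) :
    ∑ k ∈ Finset.range n, stickWeight v k = 1 - ∏ i ∈ Finset.range n, (1 - v i) := by
  induction n with
  | zero => simp
  | succ n ih => rw [Finset.sum_range_succ, ih, Finset.prod_range_succ, stickWeight]; ring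

lemma ae_betaMeasure_mem (β : ℝ) : ∀ᵐ v ∂(betaMeasure 1 β), v ∈ Ioo (0 : ℝ) 1 := by
  rw [betaMeasure, ae_withDensity_iff (by unfold betaPDF; fun_prop)]
  refine Eventually.of_forall fun v hv => ?_
  by_contra h
  exact hv (by rw [betaPDF_eq, if_neg (by exact h), ENNReal.ofReal_zero])

lemma ae_isProbabilityMeasure_stickMeasure {β : ℝ} (hβ : 0 < β) (ν : Measure X)
    [IsProbabilityMeasure ν] :
    ∀ᵐ p ∂((Measure.infinitePi fun _ : ℕ => betaMeasure 1 β).prod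
      (Measure.infinitePi fun _ : ℕ => ν)), IsProbabilityMeasure (stickMeasure p.1 p.2) := by
  have hB : IsProbabilityMeasure (betaMeasure 1 β) := isProbabilityMeasureBeta one_pos hβ
  set P := Measure.infinitePi fun _ : ℕ => betaMeasure 1 β with hP
  have h01 : ∀ᵐ v ∂P, ∀ i, v i ∈ Ioo (0 : ℝ) 1 := ae_all_iff.2 fun i =>
    (measurePreserving_eval_infinitePi (fun _ : ℕ => betaMeasure 1 β) i).quasiMeasurePreserving.ae
      (ae_betaMeasure_mem β)
  set c : ℝ≥0∞ := ∫⁻ t, ENNReal.ofReal (1 - t) ∂(betaMeasure 1 β) with hc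
  have hc1 : c < 1 := by
    have : c < ∫⁻ _, 1 ∂(betaMeasure 1 β) := by
      have hle : ∀ᵐ t ∂(betaMeasure 1 β), ENNReal.ofReal (1 - t) < 1 := by
        filter_upwards [ae_betaMeasure_mem β] with t ht
        rw [← ENNReal.ofReal_one, ENNReal.ofReal_lt_ofReal_iff one_pos]
        linarith [ht.1]
      refine lintegral_strict_mono (IsProbabilityMeasure.ne_zero _) aemeasurable_const ?_ hle
      exact ((lintegral_mono_ae (hle.mono fun _ h => h.le)).trans_lt (by simp)).ne
    simpa using this
  have hprod (n : ℕ) : ∫⁻ v, ∏ i ∈ Finset.range n, ENNReal.ofReal (1 - v i) ∂P = c ^ n := by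
    have hmeas : Measurable fun t : ℝ => ENNReal.ofReal (1 - t) := by fun_prop
    rw [lintegral_prod_eq_prod_lintegral_of_indepFun (Finset.range n)
      (fun i (v : ℕ → ℝ) => ENNReal.ofReal (1 - v i))
      (iIndepFun_infinitePi (P := fun _ : ℕ => betaMeasure 1 β) (fun _ => hmeas))
      (fun i => hmeas.comp (measurable_pi_apply i))]
    rw [Finset.prod_congr rfl fun i _ =>
      (measurePreserving_eval_infinitePi (fun _ : ℕ => betaMeasure 1 β) i).lintegral_comp hmeas]
    simp [hc]
  have hsum : ∀ᵐ v ∂P, ∑' n, ∏ i ∈ Finset.range n, ENNReal.ofReal (1 - v i) < ∞ := by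
    have hm (n : ℕ) : Measurable fun v : ℕ → ℝ => ∏ i ∈ Finset.range n, ENNReal.ofReal (1 - v i) := by
      fun_prop
    refine ae_lt_top (Measurable.tsum hm) ?_
    rw [lintegral_tsum fun n => (hm n).aemeasurable]
    simp only [hprod, ENNReal.tsum_geometric]
    exact ENNReal.inv_ne_top.2 (tsub_pos_of_lt hc1).ne'
  have hone : ∀ᵐ v ∂P, ∑' k, ENNReal.ofReal (stickWeight v k) = 1 := by
    filter_upwards [h01, hsum] with v hv hs
    have hw (k : ℕ) : 0 ≤ stickWeight v k :=
      mul_nonneg (hv k).1.le (Finset.prod_nonneg fun i _ => by linarith [(hv i).2])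
    have h0 : Tendsto (fun n => ∏ i ∈ Finset.range n, (1 - v i)) atTop (𝓝 0) := by
      have := (ENNReal.tendsto_toReal ENNReal.zero_ne_top).comp
        (ENNReal.tendsto_atTop_zero_of_tsum_ne_top hs.ne)
      refine (this.congr fun n => ?_)
      simp only [Function.comp_apply, ENNReal.toReal_prod]
      exact Finset.prod_congr rfl fun i _ => ENNReal.toReal_ofReal (by linarith [(hv i).2])
    have h1 : HasSum (stickWeight v) 1 := by
      rw [hasSum_iff_tendsto_nat_of_nonneg hw]
      simpa [sum_stickWeight] using h0.const_sub 1
    rw [← ENNReal.ofReal_tsum_of_nonneg hw h1.summable, h1.tsum_eq, ENNReal.ofReal_one]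
  have hfst := (Measure.quasiMeasurePreserving_fst (μ := P)
    (ν := Measure.infinitePi fun _ : ℕ => ν)).ae hone
  filter_upwards [hfst] with p hp
  exact ⟨by simpa [stickMeasure] using hp⟩

/-- The Dirichlet–Ferguson measure is a probability measure. -/
theorem isProbabilityMeasure_dirichletFerguson {β : ℝ} (hβ : 0 < β) (ν : Measure X)
    [IsProbabilityMeasure ν] : IsProbabilityMeasure (dirichletFerguson β ν) := by
  have hB : IsProbabilityMeasure (betaMeasure 1 β) := isProbabilityMeasureBeta one_pos hβ
  exact Measure.isProbabilityMeasure_map measurable_stickProbability.aemeasurable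

/-- The map used in the definition of `infLebesgue` is measurable. -/
lemma measurable_smul_toFiniteMeasure :
    Measurable fun p : ProbabilityMeasure X × ℝ => p.2.toNNReal • p.1.toFiniteMeasure := by
  have h : Measurable fun p : ProbabilityMeasure X × ℝ =>
      ((p.2.toNNReal • p.1.toFiniteMeasure : FiniteMeasure X) : Measure X) := by
    refine Measure.measurable_of_measurable_coe _ fun s hs => ?_
    change Measurable fun p : ProbabilityMeasure X × ℝ =>
      (p.2.toNNReal : ℝ≥0∞) * (p.1 : Measure X) s
    exact (measurable_snd.real_toNNReal.coe_nnreal_ennreal).mul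
      ((Measure.measurable_coe hs).comp (measurable_subtype_coe.comp measurable_fst))
  exact h.subtype_mk (h := fun p => (p.2.toNNReal • p.1.toFiniteMeasure : FiniteMeasure X).2)

end Nondegeneracy

end

/-! The proof combines a Mecke formula for the Dirichlet–Ferguson measure with a change of variables
in the radial direction.

Splitting off the first stick shows that `v δ_x + (1 - v) η`, with `v` of law Beta(1, θ), `x` of law
`ν` and `η` Dirichlet–Ferguson, all independent, is again Dirichlet–Ferguson
(`lintegral_finiteDirichlet_eq_stickBreak`). The Mecke formula `lintegral_finiteDirichlet_campbell`
says that a point sampled from `η` is, jointly with `η`, distributed like the newly added `x`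
jointly with the mixture. Both laws solve the same affine recursion. On the sampling side, the point
is the first atom with probability `v` and otherwise lies in the remainder (`campbell_recursion`).
On the mixture side, one more stick is broken off and its mass is exchanged with that of the first
one (`stickBreak_recursion`); this rests on the symmetry of the density `θ² (1 - a - b)^(θ - 1)` in
`lintegral_betaMeasure_swap`. The recursion contracts by `E(1 - v) < 1`, so bounded solutions
coincide (`le_of_stickBreak_recursion`).

For `μ = r η`, integration against `μ` contributes a factor `r`, and the marked atom gets mass `s =
r v`, leaving `u η` with `u = r - s`. By `lintegral_radialMeasure_betaMeasure`, `r · r^(θ - 1) dr`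
times the Beta law becomes `θ u^(θ - 1) du ds`, so `s` is Lebesgue distributed and decoupled from `u
η`. As `ν` is diffuse, almost surely `x` is not an atom of `η`, hence `μ_x = s`. -/

noncomputable section

/-! ### Shift structure of i.i.d. sequences. -/

section Sequences

/-- The sequence with first term `a` followed by the terms of `u`. -/
def consSeq {α : Type*} (a : α) (u : ℕ → α) : ℕ → α
  | 0 => a
  | n + 1 => u n

@[simp] lemma consSeq_zero {α : Type*} (a : α) (u : ℕ → α) : consSeq a u 0 = a := rfl

@[simp] lemma consSeq_succ {α : Type*} (a : α) (u : ℕ → α) (n : ℕ) :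
    consSeq a u (n + 1) = u n := rfl

variable {α : Type*} [MeasurableSpace α]

lemma measurable_consSeq : Measurable fun p : α × (ℕ → α) => consSeq p.1 p.2 := by
  refine measurable_pi_lambda _ fun n => ?_
  cases n with
  | zero => exact measurable_fst
  | succ n => exact (measurable_pi_apply n).comp measurable_snd

/-- Prepending an independent term to an i.i.d. sequence gives an i.i.d. sequence. -/
lemma map_consSeq_infinitePi (μ : Measure α) [IsProbabilityMeasure μ] :
    (μ.prod (Measure.infinitePi fun _ : ℕ => μ)).map (fun p => consSeq p.1 p.2) =
      Measure.infinitePi fun _ : ℕ => μ := by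
  classical
  refine Measure.eq_infinitePi _ fun s t ht => ?_
  obtain ⟨n, hn⟩ : ∃ n, s ⊆ Finset.range (n + 1) :=
    ⟨s.sup id, fun i hi => Finset.mem_range.2 (Nat.lt_succ_of_le (Finset.le_sup (f := id) hi))⟩
  -- Filling the free coordinates with `univ` turns the box over `s` into one over an initial
  -- segment, which splits into coordinate `0` and the shifted coordinates.
  set t' : ℕ → Set α := fun i => if i ∈ s then t i else univ with ht'
  have hm (i : ℕ) : MeasurableSet (t' i) := by
    by_cases h : i ∈ s <;> simp [ht', h, ht]
  have hpre : (fun p : α × (ℕ → α) => consSeq p.1 p.2) ⁻¹' (Set.pi (s : Set ℕ) t) =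
      t' 0 ×ˢ Set.pi (Finset.range n : Set ℕ) (fun i => t' (i + 1)) := by
    ext ⟨a, u⟩
    simp only [mem_preimage, Set.mem_pi, mem_prod, Finset.mem_coe, Finset.mem_range, ht']
    constructor
    · intro h
      refine ⟨?_, fun i _ => ?_⟩
      · split_ifs with h0
        · exact h 0 h0
        · trivial
      · split_ifs with h0
        · exact h (i + 1) h0
        · trivial
    · rintro ⟨h0, h1⟩ i hi
      cases i with
      | zero => simpa [hi] using h0
      | succ i =>
        have := h1 i (by simpa using hn hi)
        simpa [hi] using this
  rw [Measure.map_apply measurable_consSeq (MeasurableSet.pi s.countable_toSet fun i _ => ht i),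
    hpre, Measure.prod_prod, Measure.infinitePi_pi _ (fun i _ => hm _), mul_comm,
    ← Finset.prod_range_succ' (fun i => μ (t' i)) n]
  rw [← Finset.prod_subset hn fun i _ hi => by simp [ht', hi]]
  exact Finset.prod_congr rfl fun i hi => by simp [ht', hi]

end Sequences

/-! ### Joint measurability on the space of finite measures. -/

section FiniteMeasureKernel

variable {X : Type*} [MeasurableSpace X]

lemma MeasureTheory.FiniteMeasure.measurable_toMeasure :
    Measurable fun μ : FiniteMeasure X => (μ : Measure X) := measurable_subtype_coe

/-- The tautological kernel `μ ↦ μ` on finite measures. -/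
def finiteMeasureKernel (X : Type*) [MeasurableSpace X] : Kernel (FiniteMeasure X) X :=
  ⟨fun μ => (μ : Measure X), FiniteMeasure.measurable_toMeasure⟩

/-- The total mass is unbounded over all finite measures, so the kernel is cut along the integer
part `n` of the mass; each piece is bounded by `n + 1`. -/
instance : IsSFiniteKernel (finiteMeasureKernel X) := by
  classical
  have hm : Measurable fun μ : FiniteMeasure X => (μ : Measure X) univ :=
    (Measure.measurable_coe .univ).comp FiniteMeasure.measurable_toMeasure
  have hfl : Measurable fun μ : FiniteMeasure X => ⌊((μ : Measure X) univ).toReal⌋₊ :=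
    hm.ennreal_toReal.nat_floor
  have hs (n : ℕ) : MeasurableSet {μ : FiniteMeasure X | ⌊((μ : Measure X) univ).toReal⌋₊ = n} :=
    hfl (measurableSet_singleton n)
  refine ⟨fun n => Kernel.piecewise (hs n) (finiteMeasureKernel X) 0, fun n => ?_, ?_⟩
  · refine ⟨⟨n + 1, by simp, fun μ => ?_⟩⟩
    rw [Kernel.piecewise_apply]
    split_ifs with h
    · change (μ : Measure X) univ ≤ _
      rw [← ENNReal.ofReal_toReal (measure_ne_top (μ : Measure X) univ)]
      refine ENNReal.ofReal_le_of_le_toReal ?_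
      have := (Nat.lt_floor_add_one ((μ : Measure X) univ).toReal).le
      rw [show ⌊((μ : Measure X) univ).toReal⌋₊ = n from h] at this
      rw [ENNReal.toReal_add (by simp) (by simp)]
      simpa using this
    · simp
  · ext μ s hs'
    rw [Kernel.sum_apply' _ _ hs', tsum_eq_single ⌊((μ : Measure X) univ).toReal⌋₊]
    · simp [Kernel.piecewise_apply]
    · intro n hn
      rw [Kernel.piecewise_apply, if_neg (fun h => hn h.symm)]
      simp

lemma Measurable.lintegral_finiteMeasure {α : Type*} [MeasurableSpace α]
    {m : α → FiniteMeasure X} (hm : Measurable m) {f : α → X → ℝ≥0∞}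
    (hf : Measurable (Function.uncurry f)) :
    Measurable fun a => ∫⁻ x, f a x ∂(m a : Measure X) :=
  Measurable.lintegral_kernel_prod_right (κ := (finiteMeasureKernel X).comap m hm) hf

/-- The singleton `{x}` is a section of the diagonal, which is measurable, and masses of sections
under an s-finite kernel depend measurably on the parameter. -/
lemma measurable_finiteMeasure_singleton [MeasurableEq X] :
    Measurable fun p : FiniteMeasure X × X => p.1 {p.2} := by
  have h : Measurable fun p : FiniteMeasure X × X => (p.1 : Measure X) {p.2} := by
    have := Kernel.measurable_kernel_prodMk_left
      (κ := (finiteMeasureKernel X).comap (Prod.fst : FiniteMeasure X × X → _) measurable_fst)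
      (t := {q : (FiniteMeasure X × X) × X | q.2 = q.1.2})
      (measurableSet_eq_fun measurable_snd (measurable_snd.comp measurable_fst))
    exact this
  exact h.ennreal_toNNReal

lemma measurable_finiteMeasure_iff {α : Type*} [MeasurableSpace α] {m : α → FiniteMeasure X} :
    Measurable m ↔ ∀ s, MeasurableSet s → Measurable fun a => (m a : Measure X) s :=
  ⟨fun h _ hs => (Measure.measurable_coe hs).comp (FiniteMeasure.measurable_toMeasure.comp h),
    fun h => Measurable.subtype_mk (h := fun a => (m a).2)
      (Measure.measurable_of_measurable_coe _ h)⟩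

lemma measurable_finiteMeasure_add_smul {α : Type*} [MeasurableSpace α] {m m' : α → FiniteMeasure X}
    {f f' : α → ℝ≥0} (hf : Measurable f) (hf' : Measurable f')
    (hm : Measurable m) (hm' : Measurable m') :
    Measurable fun a => f a • m a + f' a • m' a := by
  rw [measurable_finiteMeasure_iff] at hm hm' ⊢
  intro s hs
  change Measurable fun a => (f a : ℝ≥0∞) * (m a : Measure X) s + f' a * (m' a : Measure X) s
  have := hm s hs
  have := hm' s hs
  fun_prop

lemma measurable_diracProba_toFiniteMeasure :
    Measurable fun x : X => (diracProba x).toFiniteMeasure :=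
  measurable_finiteMeasure_iff.2 fun _ hs =>
    (Measure.measurable_coe hs).comp Measure.measurable_dirac

end FiniteMeasureKernel

/-! ### Beta(1, θ) integrals and their changes of variables. -/

section Beta

lemma betaPDF_one_left {θ : ℝ} (hθ : 0 < θ) (t : ℝ) :
    betaPDF 1 θ t = (Ioo 0 1).indicator (fun t => ENNReal.ofReal (θ * (1 - t) ^ (θ - 1))) t := by
  rw [betaPDF_eq]
  by_cases h : t ∈ Ioo (0 : ℝ) 1
  · rw [if_pos (show 0 < t ∧ t < 1 from h), indicator_of_mem h]
    congr 1
    have : Real.Gamma θ ≠ 0 := (Real.Gamma_pos_of_pos hθ).ne'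
    rw [beta, Real.Gamma_one, add_comm, Real.Gamma_add_one hθ.ne']
    have : θ * Real.Gamma θ / Real.Gamma θ = θ := by field_simp
    simp [this]
  · rw [if_neg (show ¬(0 < t ∧ t < 1) from h), indicator_of_notMem h, ENNReal.ofReal_zero]

lemma lintegral_betaMeasure_one {θ : ℝ} (hθ : 0 < θ) {f : ℝ → ℝ≥0∞} (hf : Measurable f) :
    ∫⁻ t, f t ∂(betaMeasure 1 θ) =
      ∫⁻ t in Ioo 0 1, ENNReal.ofReal (θ * (1 - t) ^ (θ - 1)) * f t := by
  rw [betaMeasure, lintegral_withDensity_eq_lintegral_mul _ (by unfold betaPDF; fun_prop) hf,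
    ← lintegral_indicator measurableSet_Ioo]
  refine lintegral_congr fun t => ?_
  rw [Pi.mul_apply, betaPDF_one_left hθ]
  by_cases h : t ∈ Ioo (0 : ℝ) 1 <;> simp [h]

lemma lintegral_comp_const_mul {c : ℝ} (hc : 0 < c) {f : ℝ → ℝ≥0∞} (hf : Measurable f) :
    ENNReal.ofReal c * ∫⁻ t, f (c * t) = ∫⁻ t, f t := by
  conv_rhs => rw [← Real.smul_map_volume_mul_left hc.ne']
  rw [lintegral_smul_measure, lintegral_map hf (by fun_prop), abs_of_pos hc, smul_eq_mul]

/-- The image of the distribution `Beta(1, θ)` under the dilation by `c`. -/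
lemma lintegral_betaMeasure_one_const_mul {θ c : ℝ} (hθ : 0 < θ) (hc : 0 < c) {f : ℝ → ℝ≥0∞}
    (hf : Measurable f) :
    ENNReal.ofReal (c ^ θ) * ∫⁻ t, f (c * t) ∂(betaMeasure 1 θ) =
      ∫⁻ s in Ioo 0 c, ENNReal.ofReal (θ * (c - s) ^ (θ - 1)) * f s := by
  rw [lintegral_betaMeasure_one hθ (by fun_prop), ← lintegral_indicator measurableSet_Ioo,
    ← lintegral_indicator measurableSet_Ioo, ← lintegral_comp_const_mul hc
      (f := (Ioo 0 c).indicator _) (Measurable.indicator (by fun_prop) measurableSet_Ioo),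
    ← lintegral_const_mul _ (Measurable.indicator (by fun_prop) measurableSet_Ioo),
    ← lintegral_const_mul _ (f := fun t => (Ioo 0 c).indicator _ (c * t))
      ((Measurable.indicator (by fun_prop) measurableSet_Ioo).comp (measurable_const_mul c))]
  refine lintegral_congr fun t => ?_
  by_cases h : t ∈ Ioo (0 : ℝ) 1
  · have h' : c * t ∈ Ioo 0 c := ⟨mul_pos hc h.1, by nlinarith [h.2]⟩
    rw [indicator_of_mem h, indicator_of_mem h', ← mul_assoc, ← mul_assoc,
      ← ENNReal.ofReal_mul (by positivity), ← ENNReal.ofReal_mul hc.le]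
    congr 2
    -- The Jacobian contributes `c` and the density `c ^ (θ - 1)`; together they give the prefactor
    -- `c ^ θ`.
    rw [show c - c * t = c * (1 - t) by ring, Real.mul_rpow hc.le (by linarith [h.2]),
      Real.rpow_sub_one hc.ne']
    field_simp
  · have h' : c * t ∉ Ioo 0 c := fun h' => h ⟨by
      by_contra hh; nlinarith [h'.1], by by_contra hh; nlinarith [h'.2]⟩
    rw [indicator_of_notMem h, indicator_of_notMem h', mul_zero, mul_zero]

/-- The first two stick-breaking weights have, up to the bias `1 - v`, an exchangeable law. -/
lemma lintegral_betaMeasure_swap {θ : ℝ} (hθ : 0 < θ) {K : ℝ → ℝ → ℝ≥0∞}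
    (hK : Measurable (Function.uncurry K)) :
    ∫⁻ v, ENNReal.ofReal (1 - v) * ∫⁻ w, K v ((1 - v) * w) ∂(betaMeasure 1 θ) ∂(betaMeasure 1 θ) =
    ∫⁻ v, ENNReal.ofReal (1 - v) * ∫⁻ w, K ((1 - v) * w) v ∂(betaMeasure 1 θ)
      ∂(betaMeasure 1 θ) := by
  have hB : IsProbabilityMeasure (betaMeasure 1 θ) := isProbabilityMeasureBeta one_pos hθ
  set S : Set (ℝ × ℝ) := {p | 0 < p.1 ∧ 0 < p.2 ∧ p.1 + p.2 < 1} with hS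
  have hSm : MeasurableSet S := by
    refine (measurableSet_lt measurable_const measurable_fst).inter
      ((measurableSet_lt measurable_const measurable_snd).inter
        (measurableSet_lt (measurable_fst.add measurable_snd) measurable_const))
  -- The bias `1 - v` raises the Beta density to `θ (1 - v) ^ θ`, exactly the factor absorbed by
  -- dilating the second stick by `1 - v`. What is left is symmetric in the two masses.
  have key (K : ℝ → ℝ → ℝ≥0∞) (hK : Measurable (Function.uncurry K)) :
      ∫⁻ v, ENNReal.ofReal (1 - v) * ∫⁻ w, K v ((1 - v) * w) ∂(betaMeasure 1 θ)
        ∂(betaMeasure 1 θ) =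
      ∫⁻ a, ∫⁻ b, S.indicator (fun p => ENNReal.ofReal (θ ^ 2 * (1 - (p.1 + p.2)) ^ (θ - 1)) *
        K p.1 p.2) (a, b) := by
    have hK' : Measurable fun p : ℝ × ℝ => K p.1 ((1 - p.1) * p.2) :=
      hK.comp (f := fun p : ℝ × ℝ => (p.1, (1 - p.1) * p.2)) (by fun_prop)
    have hKi : Measurable fun a => ∫⁻ w, K a ((1 - a) * w) ∂(betaMeasure 1 θ) :=
      hK'.lintegral_prod_right'
    rw [lintegral_betaMeasure_one hθ (by fun_prop),
      ← lintegral_indicator measurableSet_Ioo]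
    refine lintegral_congr fun a => ?_
    have hKa : Measurable (K a) := hK.comp measurable_prodMk_left
    by_cases ha : a ∈ Ioo (0 : ℝ) 1
    · have h1 : 0 < 1 - a := by linarith [ha.2]
      rw [indicator_of_mem ha, ← mul_assoc, ← ENNReal.ofReal_mul
        (mul_nonneg hθ.le (Real.rpow_nonneg h1.le _)), mul_assoc, ← Real.rpow_add_one h1.ne',
        sub_add_cancel, ENNReal.ofReal_mul hθ.le, mul_assoc,
        lintegral_betaMeasure_one_const_mul hθ h1 hKa, ← lintegral_const_mul _ (by fun_prop),
        ← lintegral_indicator measurableSet_Ioo]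
      refine lintegral_congr fun b => ?_
      by_cases hb : b ∈ Ioo (0 : ℝ) (1 - a)
      · rw [indicator_of_mem hb, indicator_of_mem (s := S) ⟨ha.1, hb.1, by
          simp only; linarith [hb.2]⟩, ← mul_assoc, ← ENNReal.ofReal_mul hθ.le]
        congr 2
        rw [sub_sub]; ring
      · rw [indicator_of_notMem hb, indicator_of_notMem (s := S)]
        rintro ⟨-, h2, h3⟩
        exact hb ⟨h2, by simp only at h3; linarith⟩
    · rw [indicator_of_notMem ha]
      symm
      refine (lintegral_congr fun b => indicator_of_notMem (s := S) ?_ _).trans lintegral_zero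
      rintro ⟨h1, h2, h3⟩
      simp only at h1 h2 h3
      exact ha ⟨h1, by linarith⟩
  rw [key K hK, key (fun a b => K b a) (hK.comp measurable_swap), lintegral_lintegral_swap]
  · refine lintegral_congr fun a => lintegral_congr fun b => ?_
    by_cases h : (a, b) ∈ S
    · have h' : (b, a) ∈ S := ⟨h.2.1, h.1, by have := h.2.2; simp only at this ⊢; linarith⟩
      rw [indicator_of_mem h, indicator_of_mem h']
      simp only [add_comm]
    · have h' : (b, a) ∉ S := fun h' =>
        h ⟨h'.2.1, h'.1, by have := h'.2.2; simp only at this ⊢; linarith⟩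
      rw [indicator_of_notMem h, indicator_of_notMem h']
  · refine (Measurable.indicator (Measurable.mul (by fun_prop) ?_) hSm).aemeasurable
    exact hK

/-- Polar decomposition of `ds ⊗ radialMeasure θ` into a `Beta(1, θ)` angle and the sum. -/
lemma lintegral_radialMeasure_betaMeasure {θ : ℝ} (hθ : 0 < θ) {J : ℝ → ℝ → ℝ≥0∞}
    (hJ : Measurable (Function.uncurry J)) :
    ∫⁻ r, ENNReal.ofReal r * ∫⁻ t, J (r - r * t) (r * t) ∂(betaMeasure 1 θ) ∂(radialMeasure θ) =
      ENNReal.ofReal θ * ∫⁻ u, (∫⁻ s in Ioi 0, J u s) ∂(radialMeasure θ) := by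
  have hB : IsProbabilityMeasure (betaMeasure 1 θ) := isProbabilityMeasureBeta one_pos hθ
  have hG : 0 < Real.Gamma θ := Real.Gamma_pos_of_pos hθ
  have hrad (g : ℝ → ℝ≥0∞) (hg : Measurable g) : ∫⁻ r, g r ∂(radialMeasure θ) =
      ∫⁻ r in Ioi 0, ENNReal.ofReal (r ^ (θ - 1) / Real.Gamma θ) * g r := by
    rw [radialMeasure, lintegral_withDensity_eq_lintegral_mul _ (by fun_prop) hg]
    rfl
  have hJ' : Measurable fun p : ℝ × ℝ => J (p.1 - p.1 * p.2) (p.1 * p.2) :=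
    hJ.comp (f := fun p : ℝ × ℝ => (p.1 - p.1 * p.2, p.1 * p.2)) (by fun_prop)
  have hJ'' : Measurable fun p : ℝ × ℝ => J (p.1 - p.2) p.2 :=
    hJ.comp (f := fun p : ℝ × ℝ => (p.1 - p.2, p.2)) (by fun_prop)
  set S : Set (ℝ × ℝ) := {p | 0 < p.1 ∧ 0 < p.2} with hS
  have hSm : MeasurableSet S :=
    (measurableSet_lt measurable_const measurable_fst).inter
      (measurableSet_lt measurable_const measurable_snd)
  -- Both sides become integrals of this one function over the plane, in coordinates related by the
  -- shear `u = r - s`. The indicator extends it by zero so that no domains need tracking.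
  set D : ℝ × ℝ → ℝ≥0∞ := S.indicator fun p =>
    ENNReal.ofReal (θ * (p.1 ^ (θ - 1) / Real.Gamma θ)) * J p.1 p.2 with hD
  have hDm : Measurable D := by
    refine Measurable.indicator (Measurable.mul (by fun_prop) ?_) hSm
    exact hJ
  have hl : ∫⁻ r, ENNReal.ofReal r * ∫⁻ t, J (r - r * t) (r * t) ∂(betaMeasure 1 θ)
      ∂(radialMeasure θ) = ∫⁻ r, ∫⁻ s, D (r - s, s) := by
    have hJi : Measurable fun r => ∫⁻ t, J (r - r * t) (r * t) ∂(betaMeasure 1 θ) :=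
      hJ'.lintegral_prod_right'
    rw [hrad _ (by fun_prop),
      ← lintegral_indicator measurableSet_Ioi]
    refine lintegral_congr fun r => ?_
    by_cases hr : r ∈ Ioi (0 : ℝ)
    · have hr' : 0 < r := hr
      have hJr : Measurable fun s => J (r - s) s := hJ''.comp (measurable_prodMk_left (x := r))
      rw [indicator_of_mem hr, ← mul_assoc, ← ENNReal.ofReal_mul (by positivity),
        div_mul_eq_mul_div, ← Real.rpow_add_one hr'.ne', sub_add_cancel, div_eq_inv_mul,
        ENNReal.ofReal_mul (by positivity), mul_assoc,
        lintegral_betaMeasure_one_const_mul (f := fun s => J (r - s) s) hθ hr' hJr,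
        ← lintegral_const_mul _ (by fun_prop), ← lintegral_indicator measurableSet_Ioo]
      refine lintegral_congr fun s => ?_
      by_cases hs : s ∈ Ioo 0 r
      · rw [indicator_of_mem hs, hD, indicator_of_mem (s := S) ⟨by
          simp only; linarith [hs.2], hs.1⟩, ← mul_assoc, ← ENNReal.ofReal_mul (by positivity)]
        congr 2
        field_simp
      · rw [indicator_of_notMem hs, hD, indicator_of_notMem (s := S)]
        rintro ⟨h1, h2⟩
        exact hs ⟨h2, by simp only at h1; linarith⟩
    · rw [indicator_of_notMem hr]
      symm
      refine (lintegral_congr fun s => indicator_of_notMem (s := S) ?_ _).trans lintegral_zero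
      rintro ⟨h1, h2⟩
      simp only at h1 h2
      exact hr (by simp only [mem_Ioi]; linarith)
  have hr : ENNReal.ofReal θ * ∫⁻ u, (∫⁻ s in Ioi 0, J u s) ∂(radialMeasure θ) =
      ∫⁻ u, ∫⁻ s, D (u, s) := by
    have hJi : Measurable fun u => ∫⁻ s in Ioi 0, J u s := hJ.lintegral_prod_right'
    rw [hrad _ hJi, ← lintegral_const_mul _ (by fun_prop), ← lintegral_indicator measurableSet_Ioi]
    refine lintegral_congr fun u => ?_
    have hJu : Measurable (J u) := hJ.comp measurable_prodMk_left
    by_cases hu : u ∈ Ioi (0 : ℝ)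
    · have hu' : 0 < u := hu
      rw [indicator_of_mem hu, ← mul_assoc, ← ENNReal.ofReal_mul hθ.le,
        ← lintegral_const_mul _ hJu, ← lintegral_indicator measurableSet_Ioi]
      refine lintegral_congr fun s => ?_
      by_cases hs : s ∈ Ioi (0 : ℝ)
      · rw [indicator_of_mem hs, hD, indicator_of_mem (s := S) ⟨hu', mem_Ioi.1 hs⟩]
      · rw [indicator_of_notMem hs, hD, indicator_of_notMem (s := S) fun h => hs (mem_Ioi.2 h.2)]
    · rw [indicator_of_notMem hu]
      symm
      exact (lintegral_congr fun b => indicator_of_notMem (s := S) (fun h => hu (mem_Ioi.2 h.1)) _).trans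
        lintegral_zero
  -- With `s` as the outer variable, the shear is a translation of the inner one.
  rw [hl, hr, lintegral_lintegral_swap (f := fun r s => D (r - s, s)) (Measurable.aemeasurable
    (hDm.comp (f := fun p : ℝ × ℝ => (p.1 - p.2, p.2)) (by fun_prop))),
    lintegral_lintegral_swap (f := fun u s => D (u, s)) hDm.aemeasurable]
  exact lintegral_congr fun s => lintegral_sub_right_eq_self (fun u => D (u, s)) s

end Beta

/-- Needed to regroup "first stick and first atom" against "remaining sticks and remaining atoms",
whereas the construction keeps all sticks and all atoms in separate factors. -/
lemma prod_prod_eq_map {α β γ δ : Type*} [MeasurableSpace α] [MeasurableSpace β]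
    [MeasurableSpace γ] [MeasurableSpace δ] (a : Measure α) (b : Measure β) (c : Measure γ)
    (d : Measure δ) [SFinite a] [SFinite b] [SFinite c] [SFinite d] :
    (a.prod b).prod (c.prod d) = ((a.prod c).prod (b.prod d)).map
      fun q => ((q.1.1, q.2.1), (q.1.2, q.2.2)) := by
  refine Measure.ext_of_lintegral _ fun f hf => ?_
  have hm : Measurable fun q : (α × γ) × (β × δ) => ((q.1.1, q.2.1), (q.1.2, q.2.2)) := by fun_prop
  have hf' : Measurable fun q : (α × γ) × (β × δ) => f ((q.1.1, q.2.1), (q.1.2, q.2.2)) :=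
    hf.comp hm
  rw [lintegral_map hf hm, lintegral_prod _ hf.aemeasurable, lintegral_prod _ hf'.aemeasurable,
    lintegral_prod _ hf.lintegral_prod_right'.aemeasurable,
    lintegral_prod _ hf'.lintegral_prod_right'.aemeasurable]
  refine lintegral_congr fun x => ?_
  have h1 (y : β) : Measurable fun q : γ × δ => f ((x, y), q) := hf.comp measurable_prodMk_left
  have h2 (z : γ) : Measurable fun q : β × δ => f ((x, q.1), (z, q.2)) := hf.comp (by fun_prop)
  refine (lintegral_congr fun y => lintegral_prod _ (h1 y).aemeasurable).trans
    (Eq.trans ?_ (lintegral_congr fun z => lintegral_prod _ (h2 z).aemeasurable).symm)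
  refine lintegral_lintegral_swap (f := fun y z => ∫⁻ w, f ((x, y), (z, w)) ∂d) ?_
  have h3 : Measurable fun q : (β × γ) × δ => f ((x, q.1.1), (q.1.2, q.2)) :=
    hf.comp (by fun_prop)
  exact h3.lintegral_prod_right'.aemeasurable

/-! ### Self-similarity of the Dirichlet–Ferguson law. -/

section StickBreaking

variable {X : Type*} [MeasurableSpace X]

/-- The mixture `v • δ_x + (1 - v) • η`. -/
def stickBreak (v : ℝ) (x : X) (η : FiniteMeasure X) : FiniteMeasure X :=
  v.toNNReal • (diracProba x).toFiniteMeasure + (1 - v).toNNReal • η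

lemma measurable_stickBreak {α : Type*} [MeasurableSpace α] {v : α → ℝ} {x : α → X}
    {η : α → FiniteMeasure X} (hv : Measurable v) (hx : Measurable x) (hη : Measurable η) :
    Measurable fun a => stickBreak (v a) (x a) (η a) :=
  measurable_finiteMeasure_add_smul (by fun_prop) (by fun_prop)
    (measurable_diracProba_toFiniteMeasure.comp hx) hη

lemma stickBreak_toMeasure (v : ℝ) (x : X) (η : FiniteMeasure X) :
    (stickBreak v x η : Measure X) =
      ENNReal.ofReal v • Measure.dirac x + ENNReal.ofReal (1 - v) • (η : Measure X) := rfl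

lemma lintegral_stickBreak (v : ℝ) (x : X) (η : FiniteMeasure X) {f : X → ℝ≥0∞}
    (hf : Measurable f) :
    ∫⁻ y, f y ∂(stickBreak v x η : Measure X) =
      ENNReal.ofReal v * f x + ENNReal.ofReal (1 - v) * ∫⁻ y, f y ∂(η : Measure X) := by
  rw [stickBreak_toMeasure, lintegral_add_measure, lintegral_smul_measure, lintegral_smul_measure,
    lintegral_dirac' _ hf, smul_eq_mul, smul_eq_mul]

lemma stickWeight_consSeq_succ (a : ℝ) (v : ℕ → ℝ) (k : ℕ) :
    stickWeight (consSeq a v) (k + 1) = (1 - a) * stickWeight v k := by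
  simp only [stickWeight, Finset.prod_range_succ', consSeq_succ, consSeq_zero]
  ring

/-- Every weight after the first carries the common factor `1 - a`; this is the pathwise form of the
self-similarity. The bound on `a` makes `ENNReal.ofReal` multiplicative here. -/
lemma stickMeasure_consSeq {a : ℝ} (ha : a ≤ 1) (v : ℕ → ℝ) (y : X) (x : ℕ → X) :
    stickMeasure (consSeq a v) (consSeq y x) =
      ENNReal.ofReal a • Measure.dirac y + ENNReal.ofReal (1 - a) • stickMeasure v x := by
  ext s hs
  simp only [stickMeasure, Measure.sum_apply _ hs, Measure.add_apply, Measure.smul_apply,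
    smul_eq_mul]
  rw [tsum_eq_zero_add' ENNReal.summable, ← ENNReal.tsum_mul_left]
  congr 1
  · simp [stickWeight]
  · refine tsum_congr fun k => ?_
    rw [stickWeight_consSeq_succ, ENNReal.ofReal_mul (by linarith), consSeq_succ, mul_assoc]

lemma stickProbability_toMeasure {p : (ℕ → ℝ) × (ℕ → X)}
    (h : IsProbabilityMeasure (stickMeasure p.1 p.2)) :
    (stickProbability p : Measure X) = stickMeasure p.1 p.2 := by
  have e : stickProbability p = (⟨stickMeasure p.1 p.2, h⟩ : ProbabilityMeasure X) := dif_pos h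
  rw [e]
  rfl

/-- The Dirichlet–Ferguson measure as a measure on finite measures. -/
def finiteDirichlet (θ : ℝ) (ν : Measure X) : Measure (FiniteMeasure X) :=
  (dirichletFerguson θ ν).map ProbabilityMeasure.toFiniteMeasure

lemma measurable_toFiniteMeasure :
    Measurable (ProbabilityMeasure.toFiniteMeasure : ProbabilityMeasure X → FiniteMeasure X) :=
  measurable_finiteMeasure_iff.2 fun _ hs => (Measure.measurable_coe hs).comp measurable_subtype_coe

variable {θ : ℝ} {ν : Measure X}

lemma isProbabilityMeasure_finiteDirichlet [IsProbabilityMeasure ν] (hθ : 0 < θ) :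
    IsProbabilityMeasure (finiteDirichlet θ ν) := by
  have := isProbabilityMeasure_dirichletFerguson hθ ν
  exact Measure.isProbabilityMeasure_map measurable_toFiniteMeasure.aemeasurable

lemma lintegral_finiteDirichlet {H : FiniteMeasure X → ℝ≥0∞} (hH : Measurable H) :
    ∫⁻ η, H η ∂(finiteDirichlet θ ν) =
      ∫⁻ p, H (stickProbability p).toFiniteMeasure
        ∂((Measure.infinitePi fun _ : ℕ => betaMeasure 1 θ).prod
          (Measure.infinitePi fun _ : ℕ => ν)) := by
  rw [finiteDirichlet, dirichletFerguson, lintegral_map hH measurable_toFiniteMeasure,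
    lintegral_map (f := fun η : ProbabilityMeasure X => H η.toFiniteMeasure)
      (hH.comp measurable_toFiniteMeasure) measurable_stickProbability]

/-- The Dirichlet–Ferguson law is invariant under breaking off a further independent stick. -/
lemma lintegral_finiteDirichlet_eq_stickBreak [IsProbabilityMeasure ν] (hθ : 0 < θ) {H : FiniteMeasure X → ℝ≥0∞}
    (hH : Measurable H) :
    ∫⁻ η, H η ∂(finiteDirichlet θ ν) =
      ∫⁻ v, ∫⁻ x, ∫⁻ η, H (stickBreak v x η) ∂(finiteDirichlet θ ν) ∂ν ∂(betaMeasure 1 θ) := by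
  have hB : IsProbabilityMeasure (betaMeasure 1 θ) := isProbabilityMeasureBeta one_pos hθ
  have := isProbabilityMeasure_finiteDirichlet (ν := ν) hθ
  have hprob := ae_isProbabilityMeasure_stickMeasure hθ ν
  set P := Measure.infinitePi fun _ : ℕ => betaMeasure 1 θ with hP
  set N := Measure.infinitePi fun _ : ℕ => ν with hN
  have mp1 : MeasurePreserving (fun p : ℝ × (ℕ → ℝ) => consSeq p.1 p.2)
      ((betaMeasure 1 θ).prod P) P := ⟨measurable_consSeq, map_consSeq_infinitePi _⟩
  have mp2 : MeasurePreserving (fun p : X × (ℕ → X) => consSeq p.1 p.2)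
      (ν.prod N) N := ⟨measurable_consSeq, map_consSeq_infinitePi _⟩
  have hstick : Measurable fun p : (ℕ → ℝ) × (ℕ → X) => (stickProbability p).toFiniteMeasure :=
    measurable_toFiniteMeasure.comp measurable_stickProbability
  have hcomm := prod_prod_eq_map (betaMeasure 1 θ) P ν N
  have mp : MeasurePreserving (fun q : (ℝ × X) × ((ℕ → ℝ) × (ℕ → X)) =>
      (consSeq q.1.1 q.2.1, consSeq q.1.2 q.2.2))
      (((betaMeasure 1 θ).prod ν).prod (P.prod N)) (P.prod N) :=
    (mp1.prod mp2).comp (⟨by fun_prop, hcomm.symm⟩ : MeasurePreserving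
      (fun q : (ℝ × X) × ((ℕ → ℝ) × (ℕ → X)) => ((q.1.1, q.2.1), (q.1.2, q.2.2))) _ _)
  rw [lintegral_finiteDirichlet hH, ← hP, ← hN, ← mp.lintegral_comp (f := fun p => H (stickProbability p).toFiniteMeasure)
    (hH.comp hstick)]
  -- Outside a null set both the full and the tail configuration give probability measures, so the
  -- default branch of `stickProbability` is avoided, and the first stick is less than one.
  have h1 := mp.quasiMeasurePreserving.ae hprob
  have h2 := (Measure.quasiMeasurePreserving_snd (μ := (betaMeasure 1 θ).prod ν)
    (ν := P.prod N)).ae hprob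
  have h3 := ((Measure.quasiMeasurePreserving_fst (μ := betaMeasure 1 θ) (ν := ν)).comp
    (Measure.quasiMeasurePreserving_fst (μ := (betaMeasure 1 θ).prod ν)
    (ν := P.prod N))).ae (ae_betaMeasure_mem θ)
  have hH' : Measurable fun q : (ℝ × X) × FiniteMeasure X => H (stickBreak q.1.1 q.1.2 q.2) :=
    hH.comp (measurable_stickBreak (by fun_prop) (by fun_prop) (by fun_prop))
  have hH'' : Measurable fun q : (ℝ × X) × ((ℕ → ℝ) × (ℕ → X)) =>
      H (stickBreak q.1.1 q.1.2 (stickProbability q.2).toFiniteMeasure) :=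
    hH.comp (measurable_stickBreak (by fun_prop) (by fun_prop) (hstick.comp measurable_snd))
  calc _ = ∫⁻ q, H (stickBreak q.1.1 q.1.2 (stickProbability q.2).toFiniteMeasure)
        ∂(((betaMeasure 1 θ).prod ν).prod (P.prod N)) := by
        refine lintegral_congr_ae ?_
        filter_upwards [h1, h2, h3] with q h1 h2 h3
        congr 1
        refine Subtype.ext ?_
        change ((stickProbability (consSeq q.1.1 q.2.1, consSeq q.1.2 q.2.2) : ProbabilityMeasure X) :
          Measure X) = _
        refine (stickProbability_toMeasure (p := (consSeq q.1.1 q.2.1, consSeq q.1.2 q.2.2))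
          h1).trans ((stickMeasure_consSeq (a := q.1.1) (le_of_lt h3.2) _ _ _).trans ?_)
        rw [← stickProbability_toMeasure (p := q.2) h2]
        rfl
    _ = ∫⁻ q : ℝ × X, ∫⁻ η, H (stickBreak q.1 q.2 η) ∂(finiteDirichlet θ ν)
          ∂((betaMeasure 1 θ).prod ν) := by
        rw [lintegral_prod _ hH''.aemeasurable]
        refine lintegral_congr fun q => ?_
        exact (lintegral_finiteDirichlet (hH'.comp (measurable_prodMk_left (x := q)))).symm
    _ = _ := lintegral_prod _ hH'.lintegral_prod_right'.aemeasurable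

end StickBreaking

/-! ### The Mecke formula for the Dirichlet–Ferguson measure. -/

section Mecke

variable {X : Type*} [MeasurableSpace X] {θ : ℝ} {ν : Measure X} [IsProbabilityMeasure ν]

/-- This is the contraction factor of the recursion. Its value is immaterial; strictness follows
from `t > 0` almost surely. -/
lemma lintegral_one_sub_betaMeasure_lt_one (hθ : 0 < θ) :
    ∫⁻ t, ENNReal.ofReal (1 - t) ∂(betaMeasure 1 θ) < 1 := by
  have hB : IsProbabilityMeasure (betaMeasure 1 θ) := isProbabilityMeasureBeta one_pos hθ
  have hlt : ∀ᵐ t ∂(betaMeasure 1 θ), ENNReal.ofReal (1 - t) < 1 := by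
    filter_upwards [ae_betaMeasure_mem θ] with t ht
    rw [← ENNReal.ofReal_one, ENNReal.ofReal_lt_ofReal_iff one_pos]
    linarith [ht.1]
  calc _ < ∫⁻ _, 1 ∂(betaMeasure 1 θ) :=
        lintegral_strict_mono (IsProbabilityMeasure.ne_zero _) aemeasurable_const
          ((lintegral_mono_ae (hlt.mono fun _ h => h.le)).trans_lt (by simp)).ne hlt
    _ = 1 := by simp

/-- A functional bounded by one on functions bounded by one that solves the stick-breaking
recursion lies below any other solution. -/
lemma le_of_stickBreak_recursion (hθ : 0 < θ)
    {A B R : (FiniteMeasure X × X → ℝ≥0∞) → ℝ≥0∞}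
    (hA1 : ∀ G, Measurable G → (∀ q, G q ≤ 1) → A G ≤ 1)
    (hA : ∀ G, Measurable G → A G = R G + ∫⁻ v, ∫⁻ x, ENNReal.ofReal (1 - v) *
      A (fun q => G (stickBreak v x q.1, q.2)) ∂ν ∂(betaMeasure 1 θ))
    (hB : ∀ G, Measurable G → B G = R G + ∫⁻ v, ∫⁻ x, ENNReal.ofReal (1 - v) *
      B (fun q => G (stickBreak v x q.1, q.2)) ∂ν ∂(betaMeasure 1 θ))
    {G : FiniteMeasure X × X → ℝ≥0∞} (hG : Measurable G) (hG1 : ∀ q, G q ≤ 1) :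
    A G ≤ B G := by
  set c := ∫⁻ t, ENNReal.ofReal (1 - t) ∂(betaMeasure 1 θ) with hc
  -- The error is kept additive, avoiding subtraction in `ℝ≥0∞`. The bound must hold for all `G` at
  -- once, since each use of the recursion replaces `G` by its composition with `stickBreak`.
  have key (n : ℕ) : ∀ G : FiniteMeasure X × X → ℝ≥0∞, Measurable G → (∀ q, G q ≤ 1) →
      A G ≤ B G + c ^ n := by
    induction n with
    | zero => exact fun G hG hG1 => (hA1 G hG hG1).trans (by simp)
    | succ n ih =>
      intro G hG hG1
      have hsb (v : ℝ) (x : X) : Measurable fun q : FiniteMeasure X × X =>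
          G (stickBreak v x q.1, q.2) :=
        hG.comp ((measurable_stickBreak (by fun_prop) (by fun_prop) (by fun_prop)).prodMk
          measurable_snd)
      rw [hA G hG, hB G hG, add_assoc]
      gcongr
      calc _ ≤ ∫⁻ v, ∫⁻ x, (ENNReal.ofReal (1 - v) * B (fun q => G (stickBreak v x q.1, q.2)) +
            ENNReal.ofReal (1 - v) * c ^ n) ∂ν ∂(betaMeasure 1 θ) := by
            gcongr with v x
            rw [← mul_add]
            gcongr
            exact ih _ (hsb v x) fun q => hG1 _
        _ = _ := by
            -- No measurability of `B` in `(v, x)` is assumed, so additivity relies on the explicit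
            -- error term.
            simp_rw [lintegral_add_right _ measurable_const]
            rw [lintegral_add_right _ (by fun_prop)]
            simp only [lintegral_const, measure_univ, mul_one]
            rw [lintegral_mul_const _ (by fun_prop), ← hc, pow_succ']
  have hlim : Tendsto (fun n => B G + c ^ n) atTop (𝓝 (B G + 0)) :=
    (ENNReal.tendsto_pow_atTop_nhds_zero_of_lt_one
      (lintegral_one_sub_betaMeasure_lt_one hθ)).const_add _
  rw [add_zero] at hlim
  exact ge_of_tendsto' hlim fun n => key n G hG hG1

lemma measurable_lintegral_stickBreak (hθ : 0 < θ) {G : FiniteMeasure X × X → ℝ≥0∞}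
    (hG : Measurable G) : Measurable fun p : ℝ × X =>
      ∫⁻ η, G (stickBreak p.1 p.2 η, p.2) ∂(finiteDirichlet θ ν) := by
  have := isProbabilityMeasure_finiteDirichlet (ν := ν) hθ
  have : Measurable fun q : (ℝ × X) × FiniteMeasure X => G (stickBreak q.1.1 q.1.2 q.2, q.1.2) :=
    hG.comp ((measurable_stickBreak (by fun_prop) (by fun_prop) (by fun_prop)).prodMk
      (by fun_prop))
  exact this.lintegral_prod_right'

/-- Stick-breaking recursion for the Campbell measure of the Dirichlet–Ferguson measure. -/
lemma campbell_recursion (hθ : 0 < θ) {G : FiniteMeasure X × X → ℝ≥0∞} (hG : Measurable G) :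
    ∫⁻ η, ∫⁻ x, G (η, x) ∂(η : Measure X) ∂(finiteDirichlet θ ν) =
      ∫⁻ v, ∫⁻ x, ENNReal.ofReal v * ∫⁻ η, G (stickBreak v x η, x) ∂(finiteDirichlet θ ν)
        ∂ν ∂(betaMeasure 1 θ) +
      ∫⁻ v, ∫⁻ x, ENNReal.ofReal (1 - v) * ∫⁻ η, ∫⁻ y, G (stickBreak v x η, y) ∂(η : Measure X)
        ∂(finiteDirichlet θ ν) ∂ν ∂(betaMeasure 1 θ) := by
  have hB : IsProbabilityMeasure (betaMeasure 1 θ) := isProbabilityMeasureBeta one_pos hθ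
  have := isProbabilityMeasure_finiteDirichlet (ν := ν) hθ
  have hm : Measurable fun p : ℝ × X => ENNReal.ofReal p.1 *
      ∫⁻ η, G (stickBreak p.1 p.2 η, p.2) ∂(finiteDirichlet θ ν) := by
    have := measurable_lintegral_stickBreak (ν := ν) hθ hG
    fun_prop
  -- After breaking off one stick, integration against the mixture separates the marked point being
  -- the new atom from its lying in the remainder.
  rw [lintegral_finiteDirichlet_eq_stickBreak hθ
    (Measurable.lintegral_finiteMeasure (m := fun η => η) (f := fun η x => G (η, x))
      measurable_id hG)]
  rw [← lintegral_add_left (hm.lintegral_prod_right')]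
  refine lintegral_congr fun v => ?_
  refine Eq.trans ?_ (lintegral_add_left (hm.comp (measurable_prodMk_left (x := v))) _)
  refine lintegral_congr fun x => ?_
  simp only [Function.comp_apply]
  have hs : Measurable fun η : FiniteMeasure X => stickBreak v x η :=
    measurable_stickBreak (by fun_prop) (by fun_prop) measurable_id
  have h1 : Measurable fun η => G (stickBreak v x η, x) := hG.comp (hs.prodMk measurable_const)
  have h2 : Measurable fun η : FiniteMeasure X => ∫⁻ y, G (stickBreak v x η, y) ∂(η : Measure X) :=
    Measurable.lintegral_finiteMeasure measurable_id
      (hG.comp ((hs.comp measurable_fst).prodMk measurable_snd))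
  rw [← lintegral_const_mul _ h1, ← lintegral_const_mul _ h2,
    ← lintegral_add_left (h1.const_mul _)]
  refine lintegral_congr fun η => ?_
  exact lintegral_stickBreak v x η (hG.comp measurable_prodMk_left)

/-- Stick-breaking recursion for the law of an independent stick joined to a
Dirichlet–Ferguson measure. -/
lemma stickBreak_recursion (hθ : 0 < θ) {G : FiniteMeasure X × X → ℝ≥0∞} (hG : Measurable G) :
    ∫⁻ v, ∫⁻ x, ∫⁻ η, G (stickBreak v x η, x) ∂(finiteDirichlet θ ν) ∂ν ∂(betaMeasure 1 θ) =
      ∫⁻ v, ∫⁻ x, ENNReal.ofReal v * ∫⁻ η, G (stickBreak v x η, x) ∂(finiteDirichlet θ ν)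
        ∂ν ∂(betaMeasure 1 θ) +
      ∫⁻ v, ∫⁻ x, ENNReal.ofReal (1 - v) * ∫⁻ w, ∫⁻ y, ∫⁻ η, G (stickBreak v x (stickBreak w y η), y)
        ∂(finiteDirichlet θ ν) ∂ν ∂(betaMeasure 1 θ) ∂ν ∂(betaMeasure 1 θ) := by
  have hB : IsProbabilityMeasure (betaMeasure 1 θ) := isProbabilityMeasureBeta one_pos hθ
  have := isProbabilityMeasure_finiteDirichlet (ν := ν) hθ
  have hm0 := measurable_lintegral_stickBreak (ν := ν) hθ hG
  have hm : Measurable fun p : ℝ × X => ENNReal.ofReal p.1 *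
      ∫⁻ η, G (stickBreak p.1 p.2 η, p.2) ∂(finiteDirichlet θ ν) := by
    fun_prop
  have hmi (v : ℝ) : Measurable fun x =>
      ∫⁻ η, G (stickBreak v x η, x) ∂(finiteDirichlet θ ν) := by
    have := hm0.comp (measurable_prodMk_left (x := v))
    exact this
  -- `K a b` places masses `a` and `b` at independent points and marks the second one.
  set T : ℝ → ℝ → X → X → FiniteMeasure X → FiniteMeasure X := fun a b x y η =>
    -- The coefficient one only matches the form of `measurable_finiteMeasure_add_smul`.
    (1 : ℝ≥0) • (a.toNNReal • (diracProba x).toFiniteMeasure +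
      b.toNNReal • (diracProba y).toFiniteMeasure) + (1 - a - b).toNNReal • η with hT
  set K : ℝ → ℝ → ℝ≥0∞ := fun a b =>
    ∫⁻ x, ∫⁻ y, ∫⁻ η, G (T a b x y η, y) ∂(finiteDirichlet θ ν) ∂ν ∂ν with hK
  have hTm : Measurable fun q : (((ℝ × ℝ) × X) × X) × FiniteMeasure X =>
      G (T q.1.1.1.1 q.1.1.1.2 q.1.1.2 q.1.2 q.2, q.1.2) := by
    refine hG.comp (Measurable.prodMk ?_ (by fun_prop))
    refine measurable_finiteMeasure_add_smul (by fun_prop) (by fun_prop) ?_ (by fun_prop)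
    exact measurable_finiteMeasure_add_smul (by fun_prop) (by fun_prop)
      (measurable_diracProba_toFiniteMeasure.comp (by fun_prop))
      (measurable_diracProba_toFiniteMeasure.comp (by fun_prop))
  have hKm : Measurable (Function.uncurry K) :=
    hTm.lintegral_prod_right'.lintegral_prod_right'.lintegral_prod_right'
  have hTsymm (a b : ℝ) (x y : X) (η : FiniteMeasure X) : T a b x y η = T b a y x η := by
    simp only [hT, sub_sub, add_comm a b, add_comm (a.toNNReal • (diracProba x).toFiniteMeasure)]
  have hTsb {v : ℝ} (hv : v ∈ Ioo (0 : ℝ) 1) (w : ℝ) (x y : X) (η : FiniteMeasure X) :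
      stickBreak v x (stickBreak w y η) = T v ((1 - v) * w) x y η := by
    have h1 : 0 ≤ 1 - v := by linarith [hv.2]
    simp only [hT, stickBreak]
    rw [show 1 - v - (1 - v) * w = (1 - v) * (1 - w) by ring, Real.toNNReal_mul h1,
      Real.toNNReal_mul h1, one_smul, smul_add, smul_smul, smul_smul, add_assoc]
  have hmark {v : ℝ} (hv : v ∈ Ioo (0 : ℝ) 1) :
      ∫⁻ x, ∫⁻ w, ∫⁻ y, ∫⁻ η, G (stickBreak v x (stickBreak w y η), y)
        ∂(finiteDirichlet θ ν) ∂ν ∂(betaMeasure 1 θ) ∂ν =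
      ∫⁻ w, K v ((1 - v) * w) ∂(betaMeasure 1 θ) := by
    simp_rw [hTsb hv]
    rw [lintegral_lintegral_swap]
    have : Measurable fun q : X × ℝ => (((v, (1 - v) * q.2), q.1) : (ℝ × ℝ) × X) := by fun_prop
    exact (hTm.lintegral_prod_right'.lintegral_prod_right'.comp this).aemeasurable
  -- Here the marked atom is the first stick, and `η` is expanded by one further unmarked stick.
  -- Symmetry of `T` moves the marked atom to the second slot, so `K` appears with its masses
  -- exchanged.
  have hunmark {v : ℝ} (hv : v ∈ Ioo (0 : ℝ) 1) :
      ∫⁻ x, ∫⁻ η, G (stickBreak v x η, x) ∂(finiteDirichlet θ ν) ∂ν =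
      ∫⁻ w, K ((1 - v) * w) v ∂(betaMeasure 1 θ) := by
    have h1 (x : X) : ∫⁻ η, G (stickBreak v x η, x) ∂(finiteDirichlet θ ν) =
        ∫⁻ w, ∫⁻ y, ∫⁻ η, G (T ((1 - v) * w) v y x η, x) ∂(finiteDirichlet θ ν) ∂ν
          ∂(betaMeasure 1 θ) := by
      rw [lintegral_finiteDirichlet_eq_stickBreak hθ (H := fun η => G (stickBreak v x η, x))
        (hG.comp ((measurable_stickBreak (by fun_prop) (by fun_prop) measurable_id).prodMk
          measurable_const))]
      simp_rw [hTsb hv, hTsymm v]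
    have h2 : Measurable fun q : (X × ℝ) × X =>
        ((((((1 - v) * q.1.2, v), q.2), q.1.1)) : ((ℝ × ℝ) × X) × X) := by fun_prop
    have h3 := hTm.lintegral_prod_right' (ν := finiteDirichlet θ ν) |>.comp h2
    simp_rw [h1]
    rw [lintegral_lintegral_swap]
    · refine lintegral_congr fun w => ?_
      rw [lintegral_lintegral_swap]
      exact (h3.comp (f := fun p : X × X => ((p.1, w), p.2)) (by fun_prop)).aemeasurable
    · exact h3.lintegral_prod_right'.aemeasurable
  -- Write the weight one as `v + (1 - v)` and expand by a second stick only in the `1 - v` part,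
  -- which is where the exchange of the two masses applies.
  calc _ = ∫⁻ v, (∫⁻ x, ENNReal.ofReal v * ∫⁻ η, G (stickBreak v x η, x) ∂(finiteDirichlet θ ν) ∂ν +
        ENNReal.ofReal (1 - v) * ∫⁻ w, K ((1 - v) * w) v ∂(betaMeasure 1 θ)) ∂(betaMeasure 1 θ) := by
        refine lintegral_congr_ae ?_
        filter_upwards [ae_betaMeasure_mem θ] with v hv
        rw [← hunmark hv, lintegral_const_mul _ (hmi v), ← add_mul,
          ← ENNReal.ofReal_add hv.1.le (by linarith [hv.2]), add_sub_cancel, ENNReal.ofReal_one,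
          one_mul]
    _ = _ := by
        rw [lintegral_add_left hm.lintegral_prod_right', ← lintegral_betaMeasure_swap hθ hKm]
        congr 1
        refine lintegral_congr_ae ?_
        filter_upwards [ae_betaMeasure_mem θ] with v hv
        rw [← hmark hv, lintegral_const_mul' _ _ ENNReal.ofReal_ne_top]

/-- **Mecke formula** for the Dirichlet–Ferguson measure: a point sampled from the random measure
is, jointly with the measure, distributed like a newly added stick. -/
theorem lintegral_finiteDirichlet_campbell (hθ : 0 < θ) {G : FiniteMeasure X × X → ℝ≥0∞}
    (hG : Measurable G) :
    ∫⁻ η, ∫⁻ x, G (η, x) ∂(η : Measure X) ∂(finiteDirichlet θ ν) =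
      ∫⁻ v, ∫⁻ x, ∫⁻ η, G (stickBreak v x η, x) ∂(finiteDirichlet θ ν) ∂ν ∂(betaMeasure 1 θ) := by
  have hB : IsProbabilityMeasure (betaMeasure 1 θ) := isProbabilityMeasureBeta one_pos hθ
  have := isProbabilityMeasure_finiteDirichlet (ν := ν) hθ
  have hA1 (G : FiniteMeasure X × X → ℝ≥0∞) (_ : Measurable G) (hG1 : ∀ q, G q ≤ 1) :
      ∫⁻ η, ∫⁻ x, G (η, x) ∂(η : Measure X) ∂(finiteDirichlet θ ν) ≤ 1 := by
    have := isProbabilityMeasure_dirichletFerguson hθ ν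
    calc _ ≤ ∫⁻ η, ∫⁻ _, 1 ∂(η : Measure X) ∂(finiteDirichlet θ ν) := by
          gcongr; exact hG1 _
      _ = 1 := by
          rw [finiteDirichlet, lintegral_map
            (Measurable.lintegral_finiteMeasure (m := fun η => η) (f := fun _ _ => 1)
              measurable_id measurable_const)
            measurable_toFiniteMeasure]
          simp
  have hB1 (G : FiniteMeasure X × X → ℝ≥0∞) (_ : Measurable G) (hG1 : ∀ q, G q ≤ 1) :
      ∫⁻ v, ∫⁻ x, ∫⁻ η, G (stickBreak v x η, x) ∂(finiteDirichlet θ ν) ∂ν ∂(betaMeasure 1 θ) ≤ 1 :=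
    calc _ ≤ ∫⁻ v, ∫⁻ x, ∫⁻ η, 1 ∂(finiteDirichlet θ ν) ∂ν ∂(betaMeasure 1 θ) := by
          gcongr; exact hG1 _
      _ = 1 := by simp
  -- Both functionals are bounded by one, so the comparison applies in each direction.
  have hind (G : FiniteMeasure X × X → ℝ≥0∞) (hG : Measurable G) (hG1 : ∀ q, G q ≤ 1) :=
    le_antisymm
      (le_of_stickBreak_recursion (ν := ν) hθ hA1 (fun G hG => campbell_recursion hθ hG)
        (fun G hG => stickBreak_recursion hθ hG) hG hG1)
      (le_of_stickBreak_recursion (ν := ν) hθ hB1 (fun G hG => stickBreak_recursion hθ hG)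
        (fun G hG => campbell_recursion hθ hG) hG hG1)
  have hsb : Measurable fun q : (ℝ × X) × FiniteMeasure X =>
      (stickBreak q.1.1 q.1.2 q.2, q.1.2) :=
    (measurable_stickBreak (by fun_prop) (by fun_prop) (by fun_prop)).prodMk (by fun_prop)
  -- Realising both functionals as integrals against measures extends the equality from indicators
  -- to unbounded `G`.
  set M₁ := (finiteDirichlet θ ν) ⊗ₘ (finiteMeasureKernel X) with hM₁
  set M₂ := (((betaMeasure 1 θ).prod ν).prod (finiteDirichlet θ ν)).map
    fun q => (stickBreak q.1.1 q.1.2 q.2, q.1.2) with hM₂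
  have h1 (G : FiniteMeasure X × X → ℝ≥0∞) (hG : Measurable G) : ∫⁻ q, G q ∂M₁ =
      ∫⁻ η, ∫⁻ x, G (η, x) ∂(η : Measure X) ∂(finiteDirichlet θ ν) :=
    Measure.lintegral_compProd hG
  have h2 (G : FiniteMeasure X × X → ℝ≥0∞) (hG : Measurable G) : ∫⁻ q, G q ∂M₂ =
      ∫⁻ v, ∫⁻ x, ∫⁻ η, G (stickBreak v x η, x) ∂(finiteDirichlet θ ν) ∂ν ∂(betaMeasure 1 θ) := by
    have hc := hG.comp hsb
    rw [hM₂, lintegral_map hG hsb]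
    exact (lintegral_prod _ hc.aemeasurable).trans
      (lintegral_prod _ hc.lintegral_prod_right'.aemeasurable)
  have hM : M₁ = M₂ := by
    ext s hs
    have hi : Measurable (s.indicator (1 : FiniteMeasure X × X → ℝ≥0∞)) :=
      measurable_one.indicator hs
    rw [← lintegral_indicator_one hs, ← lintegral_indicator_one hs, h1 _ hi, h2 _ hi]
    exact hind _ hi fun q => indicator_le_self' (by simp) q
  rw [← h1 G hG, ← h2 G hG, hM]

end Mecke
end

/-! ### The Mecke formula for the infinite-dimensional Lebesgue measure. -/

section InfLebesgue

variable {X : Type*} [MeasurableSpace X]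

instance (θ : ℝ) : SFinite (radialMeasure θ) := by
  unfold radialMeasure
  infer_instance

lemma lintegral_infLebesgue {θ : ℝ} (hθ : 0 < θ) (ν : Measure X) [IsProbabilityMeasure ν]
    {H : FiniteMeasure X → ℝ≥0∞} (hH : Measurable H) :
    ∫⁻ μ, H μ ∂(infLebesgue θ ν) =
      ∫⁻ r, ∫⁻ η, H (r.toNNReal • η) ∂(finiteDirichlet θ ν) ∂(radialMeasure θ) := by
  have := isProbabilityMeasure_dirichletFerguson hθ ν
  have hm : Measurable fun p : ProbabilityMeasure X × ℝ => H (p.2.toNNReal • p.1.toFiniteMeasure) :=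
    hH.comp measurable_smul_toFiniteMeasure
  rw [infLebesgue, lintegral_map hH measurable_smul_toFiniteMeasure,
    lintegral_prod_symm _ hm.aemeasurable]
  refine lintegral_congr fun r => ?_
  have hr : Measurable fun η : FiniteMeasure X => r.toNNReal • η := by
    simpa using measurable_finiteMeasure_add_smul (f := fun _ => r.toNNReal) (f' := fun _ => 0)
      (m := fun η : FiniteMeasure X => η) (m' := fun η : FiniteMeasure X => η)
      measurable_const measurable_const measurable_id measurable_id
  exact (lintegral_map (hH.comp hr) measurable_toFiniteMeasure).symm

/-- A finite measure has at most countably many atoms, and `ν` does not charge countable sets. This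
is how diffuseness enters the proof. -/
lemma ae_finiteMeasure_singleton_eq_zero [MeasurableEq X] (ν : Measure X) [SFinite ν]
    [NullSingletonClass ν] (η : FiniteMeasure X) : ∀ᵐ x ∂ν, η {x} = 0 := by
  have hc : {x | 0 < (η : Measure X) {x}}.Countable :=
    Measure.countable_meas_pos_of_disjoint_iUnion (fun x => measurableSet_singleton x)
      fun x y hxy => by simpa using hxy
  filter_upwards [hc.ae_notMem ν] with x hx
  have : (η : Measure X) {x} = 0 := by simpa using hx
  change ((η : Measure X) {x}).toNNReal = 0
  simp [this]

lemma smul_stickBreak {r v : ℝ} (hr : 0 ≤ r) (x : X) (η : FiniteMeasure X) :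
    r.toNNReal • stickBreak v x η =
      (r - r * v).toNNReal • η + (r * v).toNNReal • (diracProba x).toFiniteMeasure := by
  rw [stickBreak, smul_add, smul_smul, smul_smul, ← Real.toNNReal_mul hr, ← Real.toNNReal_mul hr,
    add_comm, mul_one_sub]

lemma smul_stickBreak_singleton [MeasurableSingletonClass X] {r v : ℝ} (hr : 0 ≤ r) {x : X}
    {η : FiniteMeasure X} (hx : η {x} = 0) :
    (r.toNNReal • stickBreak v x η) {x} = (r * v).toNNReal := by
  rw [smul_stickBreak hr, FiniteMeasure.coeFn_add, Pi.add_apply, FiniteMeasure.coeFn_smul,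
    FiniteMeasure.coeFn_smul, Pi.smul_apply, Pi.smul_apply, hx]
  have : (diracProba x).toFiniteMeasure {x} = 1 := by
    change ((Measure.dirac x) {x}).toNNReal = 1
    simp
  rw [this]
  simp

/-- **Mecke formula** for the multiplicative infinite-dimensional Lebesgue measure. -/
theorem lintegral_infLebesgue_campbell [MeasurableEq X] {θ : ℝ} (hθ : 0 < θ) (ν : Measure X)
    [IsProbabilityMeasure ν] [NullSingletonClass ν]
    {F : FiniteMeasure X × ℝ≥0 × X → ℝ≥0∞} (hF : Measurable F) :
    ∫⁻ μ, (∫⁻ x, F (μ, μ {x}, x) ∂(μ : Measure X)) ∂(infLebesgue θ ν) =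
      ENNReal.ofReal θ *
        ∫⁻ μ, (∫⁻ x, (∫⁻ s in Ioi (0 : ℝ),
          F (μ + s.toNNReal • (diracProba x).toFiniteMeasure, s.toNNReal, x)) ∂ν)
            ∂(infLebesgue θ ν) := by
  have := isProbabilityMeasure_finiteDirichlet (ν := ν) hθ
  have hadd {α : Type _} [MeasurableSpace α] {a b : α → ℝ} {η : α → FiniteMeasure X} {x : α → X}
      (ha : Measurable a) (hb : Measurable b) (hη : Measurable η) (hx : Measurable x) :
      Measurable fun q => F ((a q).toNNReal • η q +
        (b q).toNNReal • (diracProba (x q)).toFiniteMeasure, (b q).toNNReal, x q) :=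
    hF.comp ((measurable_finiteMeasure_add_smul (by fun_prop) (by fun_prop) hη
      (measurable_diracProba_toFiniteMeasure.comp hx)).prodMk (by fun_prop))
  have hF1 : Measurable fun p : FiniteMeasure X × X => F (p.1, p.1 {p.2}, p.2) :=
    hF.comp (measurable_fst.prodMk (measurable_finiteMeasure_singleton.prodMk measurable_snd))
  have hsm (r : ℝ) : Measurable fun η : FiniteMeasure X => r.toNNReal • η := by
    simpa using measurable_finiteMeasure_add_smul (f := fun _ => r.toNNReal) (f' := fun _ => 0)
      (m := fun η : FiniteMeasure X => η) (m' := fun η : FiniteMeasure X => η)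
      measurable_const measurable_const measurable_id measurable_id
  set J : ℝ → ℝ → ℝ≥0∞ := fun u s => ∫⁻ x, ∫⁻ η, F (u.toNNReal • η +
    s.toNNReal • (diracProba x).toFiniteMeasure, s.toNNReal, x) ∂(finiteDirichlet θ ν) ∂ν with hJ
  have hJm : Measurable (Function.uncurry J) := by
    have : Measurable fun q : ((ℝ × ℝ) × X) × FiniteMeasure X => F (q.1.1.1.toNNReal • q.2 +
        q.1.1.2.toNNReal • (diracProba q.1.2).toFiniteMeasure, q.1.1.2.toNNReal, q.1.2) :=
      hadd (by fun_prop) (by fun_prop) (by fun_prop) (by fun_prop)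
    exact this.lintegral_prod_right'.lintegral_prod_right'
  have hrad : ∀ᵐ r ∂(radialMeasure θ), 0 < r := by
    have : radialMeasure θ ≪ volume.restrict (Ioi 0) := withDensity_absolutelyContinuous _ _
    exact this.ae_le (ae_restrict_mem measurableSet_Ioi)
  calc _ = ∫⁻ r, ENNReal.ofReal r * ∫⁻ t, J (r - r * t) (r * t) ∂(betaMeasure 1 θ)
        ∂(radialMeasure θ) := by
        rw [lintegral_infLebesgue hθ ν (Measurable.lintegral_finiteMeasure (m := fun μ => μ)
          (f := fun μ x => F (μ, μ {x}, x)) measurable_id hF1)]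
        refine lintegral_congr_ae ?_
        filter_upwards [hrad] with r hr
        have hG : Measurable fun q : FiniteMeasure X × X =>
            F (r.toNNReal • q.1, (r.toNNReal • q.1) {q.2}, q.2) :=
          hF1.comp (((hsm r).comp measurable_fst).prodMk measurable_snd)
        -- The factor `r` released here is the extra power required by
        -- `lintegral_radialMeasure_betaMeasure`.
        have hscale (η : FiniteMeasure X) : ∫⁻ x, F (r.toNNReal • η, (r.toNNReal • η) {x}, x)
            ∂((r.toNNReal • η : FiniteMeasure X) : Measure X) =
            ENNReal.ofReal r * ∫⁻ x, F (r.toNNReal • η, (r.toNNReal • η) {x}, x)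
              ∂(η : Measure X) := by
          rw [FiniteMeasure.toMeasure_smul, lintegral_smul_measure]
          rfl
        simp_rw [hscale]
        rw [lintegral_const_mul' _ _ ENNReal.ofReal_ne_top,
          lintegral_finiteDirichlet_campbell hθ hG]
        congr 1
        refine lintegral_congr fun v => ?_
        have hl : Measurable fun q : X × FiniteMeasure X => F (r.toNNReal • stickBreak v q.1 q.2,
            (r.toNNReal • stickBreak v q.1 q.2) {q.1}, q.1) :=
          hG.comp ((measurable_stickBreak (by fun_prop) (by fun_prop) (by fun_prop)).prodMk
            (by fun_prop))
        have hr' : Measurable fun q : X × FiniteMeasure X => F ((r - r * v).toNNReal • q.2 +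
            (r * v).toNNReal • (diracProba q.1).toFiniteMeasure, (r * v).toNNReal, q.1) :=
          hadd (by fun_prop) (by fun_prop) (by fun_prop) (by fun_prop)
        -- The exceptional null set of `x` consists of the atoms of `η`, so `η` has to be fixed
        -- before `x` is integrated.
        refine (lintegral_lintegral_swap hl.aemeasurable).trans
          (Eq.trans ?_ (lintegral_lintegral_swap hr'.aemeasurable).symm)
        refine lintegral_congr fun η => lintegral_congr_ae ?_
        filter_upwards [ae_finiteMeasure_singleton_eq_zero ν η] with x hx
        rw [smul_stickBreak_singleton hr.le hx, smul_stickBreak hr.le]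
    _ = ENNReal.ofReal θ * ∫⁻ u, (∫⁻ s in Ioi 0, J u s) ∂(radialMeasure θ) :=
        lintegral_radialMeasure_betaMeasure hθ hJm
    _ = _ := by
        have h1 : Measurable fun q : (FiniteMeasure X × X) × ℝ =>
            F (q.1.1 + q.2.toNNReal • (diracProba q.1.2).toFiniteMeasure, q.2.toNNReal, q.1.2) := by
          simpa using hadd (a := fun _ => 1) (b := fun q : (FiniteMeasure X × X) × ℝ => q.2)
            (η := fun q => q.1.1) (x := fun q => q.1.2) (by fun_prop) (by fun_prop)
            (by fun_prop) (by fun_prop)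
        rw [lintegral_infLebesgue hθ ν h1.lintegral_prod_right'.lintegral_prod_right']
        congr 1
        refine lintegral_congr fun u => ?_
        have h2 : Measurable fun q : (ℝ × X) × FiniteMeasure X => F (u.toNNReal • q.2 +
            q.1.1.toNNReal • (diracProba q.1.2).toFiniteMeasure, q.1.1.toNNReal, q.1.2) :=
          hadd (by fun_prop) (by fun_prop) (by fun_prop) (by fun_prop)
        have h3 : Measurable fun q : (FiniteMeasure X × X) × ℝ => F (u.toNNReal • q.1.1 +
            q.2.toNNReal • (diracProba q.1.2).toFiniteMeasure, q.2.toNNReal, q.1.2) :=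
          hadd (by fun_prop) (by fun_prop) (by fun_prop) (by fun_prop)
        refine (lintegral_lintegral_swap h2.lintegral_prod_right'.aemeasurable).trans
          (Eq.trans ?_ (lintegral_lintegral_swap h3.lintegral_prod_right'.aemeasurable).symm)
        refine lintegral_congr fun x => lintegral_lintegral_swap ?_
        exact (hadd (by fun_prop) (by fun_prop) (by fun_prop) (by fun_prop)).aemeasurable

end InfLebesgue

theorem propositionp {X : Type*} [TopologicalSpace X] [PolishSpace X] [MeasurableSpace X]
    [BorelSpace X] (ν : Measure X) [IsProbabilityMeasure ν] [NullSingletonClass ν]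
    (θ : ℝ) (hθ : 0 < θ)
    (F : FiniteMeasure X × ℝ≥0 × X → ℝ≥0∞) (hF : Measurable[borel _] F) :
    ∫⁻ μ, (∫⁻ x, F (μ, μ {x}, x) ∂(μ : Measure X)) ∂(infLebesgue θ ν) =
      ENNReal.ofReal θ *
        ∫⁻ μ, (∫⁻ x, (∫⁻ s in Ioi (0 : ℝ),
          F (μ + s.toNNReal • (diracProba x).toFiniteMeasure, s.toNNReal, x)) ∂ν)
            ∂(infLebesgue θ ν) := by
  -- The weak topology is second countable and its Borel sets are generated by the evaluations, so
  -- Borel measurability on the product is measurability for the product σ-algebra.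
  rw [← BorelSpace.measurable_eq (α := FiniteMeasure X × ℝ≥0 × X)] at hF
  exact lintegral_infLebesgue_campbell hθ ν hF
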